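/- Let $n\ge 1$, let $\mathbb F_n$ be the free group on $a_1,\dots,a_n$ with word length $|\cdot|$, and let $F$ be a finite group. Let $B=\bigoplus_{\mathbb F_n}F$ be the group of finitely supported functions $\mathbb F_n\to F$, on which $\mathbb F_n$ acts by $(v\cdot f)(w)=f(v^{-1}w)$, and let $\Gamma=F\wr\mathbb F_n=B\rtimes\mathbb F_n$. For $k\ge 1$ let $B_k\le B$ be the finite subgroup of functions supported in $\{w:|w|\le k\}$. Let $T$ be (the geometric realization of) the tree with vertex set and edge set both equal to $\coprod_{k\ge1}B/B_k$, where the edge labelled $bB_k$ joins the vertex $bB_k$ to the vertex $bB_{k+1}$. For $w\in\mathbb F_n$ let $T_w$ be a copy of $T$, with vertices written $bB_{k,w}$ and with the $B$-action $f\cdot_w bB_{k,w}=((w^{-1}\cdot f)\,b)B_{k,w}$. For $1\le j\le n$ let $\varphi_w^{a_j}\colon T_w\to T_{wa_j}$ be the $B$-equivariant simplicial map $bB_{k,w}\mapsto (a_j^{-1}\cdot b)B_{k+1,wa_j}$. For every edge $[w,wa_j]\cong[0,1]$ of the Cayley graph of $\mathbb F_n$ ($w\in\mathbb F_n$, $1\le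 j\le n$) take the space $T_w\times[w,wa_j]$. The mapping telescope $Z$ is the quotient of the disjoint union of these spaces and of the spaces $T_w$ ($w\in\mathbb F_n$), with the quotient topology, obtained by identifying, for all $w$, $j$ and $x\in T_w$, the point $(x,w)\in T_w\times[w,wa_j]$ with $x\in T_w$, and the point $(x,wa_j)\in T_w\times[w,wa_j]$ with $\varphi_w^{a_j}(x)\in T_{wa_j}$. The group $\Gamma$ acts on $Z$: an element $v\in\mathbb F_n$ carries $T_w\times[w,wa_j]$ to $T_{vw}\times[vw,vwa_j]$ by the identity of $T$ and translation of the edge (and $T_w$ to $T_{vw}$ by the identity of $T$), and $f\in B$ acts on $T_w$ and on the first factor of $T_w\times[w,wa_j]$ by $f\cdot_w$. Then $Z$, with this action, is a $2$-dimensional model for the classifying space for proper actions $\underline{E}\Gamma$: it is a $\Gamma$-CW-complex of dimension $2$ such that, for every subgroup $H\le\Gamma$, the fixed point set $Z^H$ is contractible if $H$ is finite and empty if $H$ is infinite. -/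

import Mathlib

open scoped unitInterval

namespace WreathFree

universe u

/-! ### The groups `B = ⨁_{𝔽ₙ} F` and `Γ = F ≀ 𝔽ₙ = B ⋊ 𝔽ₙ` -/

/-- `B = ⨁_{𝔽ₙ} F`: the finitely supported functions `𝔽ₙ → F`, with pointwise multiplication. -/
def Base (F : Type u) [Group F] (n : ℕ) : Subgroup (FreeGroup (Fin n) → F) where
  carrier := {f | (Function.mulSupport f).Finite}
  mul_mem' {a b} ha hb := (Set.Finite.union ha hb).subset (Function.mulSupport_mul a b)
  one_mem' := by simp
  inv_mem' {a} ha := by simpa using ha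

/-- The action of `𝔽ₙ` on `B` by left translation of the indices: `(v · f)(w) = f (v⁻¹ w)`. -/
def shift (F : Type u) [Group F] (n : ℕ) : FreeGroup (Fin n) →* MulAut (Base F n) where
  toFun v :=
    { toFun f := ⟨fun w => f.1 (v⁻¹ * w),
        Set.Finite.preimage (Function.Injective.injOn (mul_right_injective v⁻¹)) f.2⟩
      invFun f := ⟨fun w => f.1 (v * w),
        Set.Finite.preimage (Function.Injective.injOn (mul_right_injective v)) f.2⟩
      left_inv f := by ext w; simp
      right_inv f := by ext w; simp
      map_mul' f g := by ext w; simp }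
  map_one' := by ext f w; simp
  map_mul' v v' := by ext f w; simp [mul_assoc]

@[simp] theorem shift_apply (F : Type u) [Group F] (n : ℕ) (v w : FreeGroup (Fin n))
    (f : Base F n) : (shift F n v f).1 w = f.1 (v⁻¹ * w) := rfl

/-- The (restricted) wreath product `Γ = F ≀ 𝔽ₙ = B ⋊ 𝔽ₙ`. -/
abbrev Wreath (F : Type u) [Group F] (n : ℕ) : Type u :=
  SemidirectProduct (Base F n) (FreeGroup (Fin n)) (shift F n)

/-- `Bₖ ≤ B`: the functions supported in the ball of radius `k` of `𝔽ₙ` (word metric). -/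
def ballSubgroup (F : Type u) [Group F] (n k : ℕ) : Subgroup (Base F n) where
  carrier := {f | ∀ w, f.1 w ≠ 1 → w.norm ≤ k}
  mul_mem' {a b} ha hb w hw := by
    by_cases h : a.1 w = 1
    · exact hb w (fun h' => hw (by simp [h, h']))
    · exact ha w h
  one_mem' w hw := absurd rfl hw
  inv_mem' {a} ha w hw := ha w (fun h => hw (by simp [h]))

theorem ballSubgroup_mono (F : Type u) [Group F] (n : ℕ) {k l : ℕ} (h : k ≤ l) :
    ballSubgroup F n k ≤ ballSubgroup F n l := fun _ hf w hw => (hf w hw).trans h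

theorem shift_of_inv_mem (F : Type u) [Group F] (n k : ℕ) (j : Fin n) {f : Base F n}
    (hf : f ∈ ballSubgroup F n k) :
    shift F n (FreeGroup.of j)⁻¹ f ∈ ballSubgroup F n (k + 1) := by
  intro w hw
  rw [shift_apply, inv_inv] at hw
  have h1 : (FreeGroup.of j * w).norm ≤ k := hf _ hw
  have h2 := FreeGroup.norm_mul_le (FreeGroup.of j)⁻¹ (FreeGroup.of j * w)
  rw [inv_mul_cancel_left, FreeGroup.norm_inv_eq, FreeGroup.norm_of] at h2
  omega

/-! ### The tree `T` -/

/-- The vertices `V = ∐_{k > 0} B / Bₖ` of `T`. The set of edges is the same set. -/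
def Vertex (F : Type u) [Group F] (n : ℕ) : Type u :=
  Σ k : ℕ+, Base F n ⧸ ballSubgroup F n (k : ℕ)

/-- The sets of vertices and edges are discrete. -/
instance (F : Type u) [Group F] (n : ℕ) : TopologicalSpace (Vertex F n) := ⊥

/-- `b Bₖ ↦ b Bₖ₊₁`. -/
def Vertex.up {F : Type u} [Group F] {n : ℕ} (v : Vertex F n) : Vertex F n :=
  ⟨v.1 + 1, Subgroup.quotientMapOfLE
    (ballSubgroup_mono F n (by simp) :
      ballSubgroup F n (v.1 : ℕ) ≤ ballSubgroup F n ((v.1 + 1 : ℕ+) : ℕ)) v.2⟩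

/-- The left translation action of `B`: `f · b Bₖ = (f b) Bₖ`. -/
instance (F : Type u) [Group F] (n : ℕ) : MulAction (Base F n) (Vertex F n) where
  smul f v := ⟨v.1, f • v.2⟩
  one_smul v := Sigma.ext rfl (heq_of_eq (one_smul _ v.2))
  mul_smul f g v := Sigma.ext rfl (heq_of_eq (mul_smul f g v.2))

/-- The gluing map on vertices: `b Bₖ ↦ (aⱼ⁻¹ · b) Bₖ₊₁`. -/
def Vertex.glue {F : Type u} [Group F] {n : ℕ} (j : Fin n) (v : Vertex F n) : Vertex F n :=
  ⟨v.1 + 1, Quotient.map' (shift F n (FreeGroup.of j)⁻¹) (fun a b h => by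
    rw [QuotientGroup.leftRel_apply] at h ⊢
    rw [← map_inv, ← map_mul]
    exact shift_of_inv_mem F n _ j h) v.2⟩

theorem Vertex.up_smul {F : Type u} [Group F] {n : ℕ} (f : Base F n) (v : Vertex F n) :
    f • v.up = (f • v).up := by
  obtain ⟨k, q⟩ := v
  induction q using QuotientGroup.induction_on with
  | H b => rfl

theorem Vertex.up_glue {F : Type u} [Group F] {n : ℕ} (j : Fin n) (v : Vertex F n) :
    v.up.glue j = (v.glue j).up := by
  obtain ⟨k, q⟩ := v
  induction q using QuotientGroup.induction_on with
  | H b => rfl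

theorem Vertex.glue_smul {F : Type u} [Group F] {n : ℕ} (j : Fin n) (f : Base F n)
    (v : Vertex F n) :
    (f • v).glue j = shift F n (FreeGroup.of j)⁻¹ f • v.glue j := by
  obtain ⟨k, q⟩ := v
  induction q using QuotientGroup.induction_on with
  | H b =>
    refine Sigma.ext rfl (heq_of_eq ?_)
    exact congrArg QuotientGroup.mk (map_mul (shift F n (FreeGroup.of j)⁻¹) f b)

/-- The edge labelled `b Bₖ` is an interval which joins the vertex `b Bₖ` to `b Bₖ₊₁`. -/
inductive TreeRel (F : Type u) [Group F] (n : ℕ) :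
    Vertex F n ⊕ (Vertex F n × I) → Vertex F n ⊕ (Vertex F n × I) → Prop
  | source (e : Vertex F n) : TreeRel F n (Sum.inr (e, 0)) (Sum.inl e)
  | target (e : Vertex F n) : TreeRel F n (Sum.inr (e, 1)) (Sum.inl e.up)

/-- The tree `T`, as a topological space: the geometric realization of the graph with vertices
`V`, edges `E = V`, the edge `b Bₖ` running from `b Bₖ` to `b Bₖ₊₁`. -/
def Tree (F : Type u) [Group F] (n : ℕ) : Type u := Quot (TreeRel F n)

instance (F : Type u) [Group F] (n : ℕ) : TopologicalSpace (Tree F n) :=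
  inferInstanceAs (TopologicalSpace (Quot (TreeRel F n)))

/-- The map of `T` that is given on vertices and edges by `g` and is affine on edges. -/
def Tree.map {F : Type u} [Group F] {n : ℕ} (g : Vertex F n → Vertex F n)
    (hg : ∀ v, g v.up = (g v).up) : Tree F n → Tree F n :=
  Quot.map (Sum.map g (Prod.map g id)) (by
    rintro _ _ (e | e)
    · exact TreeRel.source (g e)
    · have h := TreeRel.target (g e)
      rw [← hg] at h
      exact h)

/-- The action of `B` on `T`, induced by `f · b Bₖ = (f b) Bₖ`. -/
instance (F : Type u) [Group F] (n : ℕ) : MulAction (Base F n) (Tree F n) where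
  smul f := Tree.map (f • ·) (Vertex.up_smul f)
  one_smul := by
    rintro ⟨v | ⟨e, t⟩⟩
    · exact congrArg (fun v => Quot.mk (TreeRel F n) (Sum.inl v)) (one_smul (Base F n) v)
    · exact congrArg (fun e => Quot.mk (TreeRel F n) (Sum.inr (e, t))) (one_smul (Base F n) e)
  mul_smul f g := by
    rintro ⟨v | ⟨e, t⟩⟩
    · exact congrArg (fun v => Quot.mk (TreeRel F n) (Sum.inl v)) (mul_smul f g v)
    · exact congrArg (fun e => Quot.mk (TreeRel F n) (Sum.inr (e, t))) (mul_smul f g e)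

/-- The gluing map `φ^{aⱼ} : T_w → T_{w aⱼ}`, `b Bₖ ↦ (aⱼ⁻¹ · b) Bₖ₊₁` (the same formula for
every `w`). -/
def Tree.glue {F : Type u} [Group F] {n : ℕ} (j : Fin n) : Tree F n → Tree F n :=
  Tree.map (Vertex.glue j) (Vertex.up_glue j)

theorem Tree.glue_smul {F : Type u} [Group F] {n : ℕ} (j : Fin n) (f : Base F n)
    (x : Tree F n) :
    Tree.glue j (f • x) = shift F n (FreeGroup.of j)⁻¹ f • Tree.glue j x := by
  obtain ⟨v | ⟨e, t⟩⟩ := x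
  · exact congrArg (fun v => Quot.mk (TreeRel F n) (Sum.inl v)) (Vertex.glue_smul j f v)
  · exact congrArg (fun e => Quot.mk (TreeRel F n) (Sum.inr (e, t))) (Vertex.glue_smul j f e)

/-! ### The mapping telescope `Z` -/

/-- The pieces from which `Z` is glued: a copy `T_w` (that is `T_w × {w}`) of `T` for every vertex
`w` of the Cayley graph of `𝔽ₙ`, and a copy `T_w × [w, w aⱼ]` of `T × [0, 1]` for every edge
`[w, w aⱼ]`; the point `w` of the edge is `0` and the point `w aⱼ` is `1`. -/
abbrev Pieces (F : Type u) [Group F] (n : ℕ) : Type u :=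
  (Σ _ : FreeGroup (Fin n), Tree F n) ⊕ (Σ _ : FreeGroup (Fin n) × Fin n, Tree F n × I)

/-- `T_w × {w} ⊆ T_w × [w, w aⱼ]` is identified with `T_w` by the identity, and the end
`T_w × {w aⱼ}` is glued to `T_{w aⱼ}` by `φ^{aⱼ}`. -/
inductive TelescopeRel (F : Type u) [Group F] (n : ℕ) : Pieces F n → Pieces F n → Prop
  | source (w : FreeGroup (Fin n)) (j : Fin n) (x : Tree F n) :
      TelescopeRel F n (Sum.inr ⟨(w, j), (x, 0)⟩) (Sum.inl ⟨w, x⟩)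
  | target (w : FreeGroup (Fin n)) (j : Fin n) (x : Tree F n) :
      TelescopeRel F n (Sum.inr ⟨(w, j), (x, 1)⟩) (Sum.inl ⟨w * FreeGroup.of j, x.glue j⟩)

/-- The mapping telescope `Z`, with the quotient topology. -/
def Telescope (F : Type u) [Group F] (n : ℕ) : Type u := Quot (TelescopeRel F n)

instance (F : Type u) [Group F] (n : ℕ) : TopologicalSpace (Telescope F n) :=
  inferInstanceAs (TopologicalSpace (Quot (TelescopeRel F n)))

/-- The action of `f ∈ B` on `T_w`: `f ·_w b Bₖ = ((w⁻¹ · f) b) Bₖ`. -/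
def twist {F : Type u} [Group F] {n : ℕ} (w : FreeGroup (Fin n)) (f : Base F n)
    (x : Tree F n) : Tree F n := shift F n w⁻¹ f • x

/-- The gluing maps are `B`-equivariant. -/
theorem glue_twist {F : Type u} [Group F] {n : ℕ} (w : FreeGroup (Fin n)) (j : Fin n)
    (f : Base F n) (x : Tree F n) :
    Tree.glue j (twist w f x) = twist (w * FreeGroup.of j) f (Tree.glue j x) := by
  rw [twist, twist, Tree.glue_smul, mul_inv_rev, map_mul, MulAut.mul_apply]

/-- The action of `γ = (f, v) = f v ∈ Γ` on the pieces: first `v` moves `T_w` to `T_{v w}` and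
`T_w × [w, w aⱼ]` to `T_{v w} × [v w, v w aⱼ]`, then `f` acts on `T_{v w}`. -/
def piecesSMul {F : Type u} [Group F] {n : ℕ} (γ : Wreath F n) : Pieces F n → Pieces F n
  | Sum.inl ⟨w, x⟩ => Sum.inl ⟨γ.right * w, twist (γ.right * w) γ.left x⟩
  | Sum.inr ⟨(w, j), (x, t)⟩ =>
      Sum.inr ⟨(γ.right * w, j), (twist (γ.right * w) γ.left x, t)⟩

theorem piecesSMul_rel {F : Type u} [Group F] {n : ℕ} (γ : Wreath F n) (p q : Pieces F n)
    (h : TelescopeRel F n p q) : TelescopeRel F n (piecesSMul γ p) (piecesSMul γ q) := by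
  rcases h with ⟨w, j, x⟩ | ⟨w, j, x⟩
  · exact TelescopeRel.source _ _ _
  · have h := TelescopeRel.target (γ.right * w) j (twist (γ.right * w) γ.left x)
    rw [glue_twist, mul_assoc] at h
    exact h

theorem twist_one {F : Type u} [Group F] {n : ℕ} (w : FreeGroup (Fin n)) (x : Tree F n) :
    twist w 1 x = x := by
  rw [twist, map_one, one_smul]

theorem twist_mul {F : Type u} [Group F] {n : ℕ} (γ δ : Wreath F n) (w : FreeGroup (Fin n))
    (x : Tree F n) :
    twist (γ.right * (δ.right * w)) (γ.left * shift F n γ.right δ.left) x =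
      twist (γ.right * (δ.right * w)) γ.left (twist (δ.right * w) δ.left x) := by
  simp only [twist, map_mul, mul_smul]
  rw [← MulAut.mul_apply, ← map_mul]
  simp

/-- The action of `Γ` on `Z`. -/
instance (F : Type u) [Group F] (n : ℕ) : MulAction (Wreath F n) (Telescope F n) where
  smul γ := Quot.map (piecesSMul γ) (piecesSMul_rel γ)
  one_smul := by
    rintro ⟨⟨w, x⟩ | ⟨⟨w, j⟩, ⟨x, t⟩⟩⟩ <;> refine congrArg (Quot.mk _) ?_ <;>
      simp only [piecesSMul, SemidirectProduct.one_left, SemidirectProduct.one_right, one_mul,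
        twist_one]
  mul_smul γ δ := by
    rintro ⟨⟨w, x⟩ | ⟨⟨w, j⟩, ⟨x, t⟩⟩⟩ <;> refine congrArg (Quot.mk _) ?_ <;>
      simp only [piecesSMul, SemidirectProduct.mul_left, SemidirectProduct.mul_right,
        twist_mul, mul_assoc]

/-! ### Models for the classifying space for proper actions -/

/-- A `G`-CW-structure on `X` (`G` discrete): a CW-structure whose characteristic maps are
permuted by `G`. Since distinct open cells are disjoint, `j` below is unique, so that `G` acts on
the set of `m`-cells, and the characteristic maps of an orbit with stabilizer `H` form a `G`-map
`G/H × Dᵐ → X`. -/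
def IsGCW (G : Type*) {X : Type u} [Group G] [MulAction G X] [TopologicalSpace X]
    (K : Topology.CWComplex (Set.univ : Set X)) : Prop :=
  ∀ (m : ℕ) (i : K.cell m) (g : G), ∃ j : K.cell m,
    ∀ x ∈ Metric.closedBall (0 : Fin m → ℝ) 1, K.map m j x = g • K.map m i x

/-- The CW-complex is of dimension exactly `d`. -/
def HasDim {X : Type u} [TopologicalSpace X] (K : Topology.CWComplex (Set.univ : Set X))
    (d : ℕ) : Prop :=
  Nonempty (K.cell d) ∧ ∀ m, d < m → IsEmpty (K.cell m)

/-- `X` is a `d`-dimensional model for the classifying space for proper actions of the discrete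
group `G`: a `d`-dimensional `G`-CW-complex in which the fixed point set of a subgroup `H` is
contractible if `H` is finite, and empty if `H` is infinite. -/
structure IsModelEProper (G : Type*) (X : Type u) [Group G] [TopologicalSpace X]
    [MulAction G X] (d : ℕ) : Prop where
  t2 : T2Space X
  continuous_smul : ContinuousConstSMul G X
  gcw : ∃ K : Topology.CWComplex (Set.univ : Set X), IsGCW G K ∧ HasDim K d
  contractible_fixedPoints : ∀ H : Subgroup G, Finite H →
    ContractibleSpace (MulAction.fixedPoints H X)
  fixedPoints_empty : ∀ H : Subgroup G, Infinite H → MulAction.fixedPoints H X = ∅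

end WreathFree

/-!
The proof has three independent parts.

*Contractibility.* A finite subgroup `H` of `Γ` lies in `B`, because free groups are torsion-free
(`right_eq_one_of_finite`), and hence in some `Bₖ`; so it fixes a vertex of `T_1`. It remains to
contract `Z`, and every homotopy that commutes with `H` restricts to the fixed points of `H`.
The tree `T` has a `B`-equivariant upward flow (`Tree.flow`), and any two ascending rays merge.
Moving up until the ray of a fixed vertex is met, and then down along this ray, contracts `T`
(`Tree.contractible_fixed`). For `Z`, the maps `b Bₖ ↦ (aⱼ · b) Bₖ₊₁` (`Tree.coglue`) are inverse to
the gluing maps up to the flow by `2`. So, after a point has been moved up far enough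
(`Telescope.raise`), the geodesic to `1` in the Cayley graph can be lifted to `Z`, also against the
direction of the gluing maps (`Telescope.path`). Following the lifts (`Telescope.shrink`) deforms
`Z` into `T_1`, equivariantly for `B` (`Telescope.contractible_fixed`). All maps out of the quotient
spaces `T` and `Z` are shown to be continuous on the pieces; for homotopies this suffices since `I`
is locally compact.

*The CW-structure.* The cells (`Cell`) are the products of a cell of the Cayley graph and a cell of
the tree. Linear interpolation of functions along the edges gives enough continuous functions
`Z → ℝ` to show that `Z` is Hausdorff (`Telescope.eq_of_forall_continuous`) and to invert each
characteristic map by a continuous map that is defined on all of `Z` (`Cell.charInv`). The open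
cell that contains a given point (`Cell.ofPoint`) is defined by cases on the pieces, which gives
the disjointness of the open cells.

*Stabilizers.* An element that fixes a point fixes the open cell of this point. Hence it lies in
`B`, since `𝔽ₙ` acts freely on itself, and up to translation of the indices it lies in a conjugate
of some `Bₖ`, which is a finite group (`Telescope.finite_stabilizer`).
-/

noncomputable section

namespace WreathFree

universe u

variable {F : Type u} [Group F] {n : ℕ}

/-! ### Points of the tree and continuity of maps out of it -/

instance (F : Type u) [Group F] (n : ℕ) : DiscreteTopology (Vertex F n) := ⟨rfl⟩

namespace Tree

/-- The vertex `v` as a point of the tree. -/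
def vert (v : Vertex F n) : Tree F n := Quot.mk _ (Sum.inl v)

/-- The point with parameter `t` on the edge from `e` to `e.up`. -/
def edge (e : Vertex F n) (t : I) : Tree F n := Quot.mk _ (Sum.inr (e, t))

theorem edge_zero (e : Vertex F n) : edge e 0 = vert e := Quot.sound (TreeRel.source e)

theorem edge_one (e : Vertex F n) : edge e 1 = vert e.up := Quot.sound (TreeRel.target e)

theorem continuous_edge (e : Vertex F n) : Continuous (edge e) :=
  continuous_quot_mk.comp (continuous_inr.comp (by fun_prop))

theorem exists_edge (x : Tree F n) : ∃ e t, x = edge e t := by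
  obtain ⟨v | ⟨e, t⟩⟩ := x
  · exact ⟨v, 0, (edge_zero v).symm⟩
  · exact ⟨e, t, rfl⟩

theorem smul_edge (f : Base F n) (e : Vertex F n) (t : I) : f • edge e t = edge (f • e) t := rfl

theorem smul_vert (f : Base F n) (v : Vertex F n) : f • vert v = vert (f • v) := rfl

theorem continuous_of_edge {Y : Type*} [TopologicalSpace Y] {f : Tree F n → Y}
    (h : ∀ e, Continuous fun t => f (edge e t)) : Continuous f := by
  refine continuous_coinduced_dom.2 (continuous_sum_dom.2 ⟨continuous_of_discreteTopology, ?_⟩)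
  exact continuous_prod_of_discrete_left.2 h

/-- Since the parameter space is locally compact, a map out of `T × A` is continuous as soon as
it is continuous on every edge times `A`. -/
theorem continuous_prod_of_edge {A Y : Type*} [TopologicalSpace A] [LocallyCompactSpace A]
    [TopologicalSpace Y] {f : Tree F n × A → Y}
    (h : ∀ e, Continuous fun p : I × A => f (edge e p.1, p.2)) : Continuous f := by
  have h1 : ∀ x, Continuous fun a => f (x, a) := by
    intro x
    obtain ⟨e, t, rfl⟩ := exists_edge x
    exact (h e).comp (Continuous.prodMk_right t)
  let g : Tree F n → C(A, Y) := fun x => ⟨fun a => f (x, a), h1 x⟩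
  have hg : Continuous g :=
    continuous_of_edge fun e => ContinuousMap.continuous_of_continuous_uncurry _ (h e)
  exact ContinuousMap.continuous_uncurry_of_continuous ⟨g, hg⟩

@[fun_prop]
theorem continuous_map (g : Vertex F n → Vertex F n) (hg : ∀ v, g v.up = (g v).up) :
    Continuous (Tree.map g hg) :=
  continuous_of_edge fun e => continuous_edge (g e)

theorem map_edge (g : Vertex F n → Vertex F n) (hg : ∀ v, g v.up = (g v).up) (e : Vertex F n)
    (t : I) : Tree.map g hg (edge e t) = edge (g e) t := rfl

theorem continuous_glue (j : Fin n) : Continuous (Tree.glue (F := F) j) := continuous_map _ _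

theorem continuous_smul (f : Base F n) : Continuous fun x : Tree F n => f • x :=
  continuous_map _ _

/-- The map given on the edge from `e` to `e.up` by `φ e`. -/
def lift {Y : Type*} (φ : Vertex F n → I → Y) (h : ∀ e, φ e 1 = φ e.up 0) : Tree F n → Y :=
  Quot.lift (Sum.elim (fun v => φ v 0) fun p => φ p.1 p.2) (by
    rintro _ _ (e | e)
    · rfl
    · exact h e)

theorem lift_edge {Y : Type*} (φ : Vertex F n → I → Y) (h : ∀ e, φ e 1 = φ e.up 0)
    (e : Vertex F n) (t : I) : lift φ h (edge e t) = φ e t := rfl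

theorem lift_vert {Y : Type*} (φ : Vertex F n → I → Y) (h : ∀ e, φ e 1 = φ e.up 0)
    (e : Vertex F n) : lift φ h (vert e) = φ e 0 := rfl

/-! ### The upward flow on the tree -/

/-- The ray that starts at `e` and runs through `e.up`, `e.up.up`, …; at negative times it stays
at `e`. -/
def ray (e : Vertex F n) (s : ℝ) : Tree F n :=
  edge (Vertex.up^[⌊s⌋₊] e) (Set.projIcc 0 1 zero_le_one (s - ⌊s⌋₊))

theorem ray_of_le_one (e : Vertex F n) {s : ℝ} (hs : s ≤ 1) :
    ray e s = edge e (Set.projIcc 0 1 zero_le_one s) := by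
  rcases hs.lt_or_eq with h | rfl
  · rw [ray, Nat.floor_eq_zero.2 h]
    simp
  · simp only [ray, Nat.floor_one, Nat.cast_one, sub_self, Set.projIcc_left, Set.projIcc_right]
    exact (edge_zero _).trans (edge_one e).symm

theorem ray_coe (e : Vertex F n) (t : I) : ray e t = edge e t := by
  rw [ray_of_le_one e t.2.2, Set.projIcc_val]

theorem ray_add_one (e : Vertex F n) {s : ℝ} (hs : 0 ≤ s) : ray e (s + 1) = ray e.up s := by
  rw [ray, ray, Nat.floor_add_one hs, Function.iterate_succ_apply]
  push_cast
  rw [add_sub_add_right_eq_sub]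

theorem ray_add_nat (e : Vertex F n) {s : ℝ} (hs : 0 ≤ s) (k : ℕ) :
    ray e (s + k) = ray (Vertex.up^[k] e) s := by
  induction k generalizing e with
  | zero => simp
  | succ k ih =>
    rw [Function.iterate_succ_apply, ← ih, ← ray_add_one _ (by positivity), Nat.cast_succ,
      add_assoc]

theorem ray_of_nonpos (e : Vertex F n) {s : ℝ} (hs : s ≤ 0) : ray e s = vert e := by
  rw [ray_of_le_one e (hs.trans zero_le_one), Set.projIcc_of_le_left _ hs]
  exact edge_zero e

theorem ray_zero (e : Vertex F n) : ray e 0 = vert e := ray_of_nonpos e le_rfl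

@[fun_prop]
theorem continuous_ray (e : Vertex F n) : Continuous (ray e) := by
  have key : ∀ (k : ℕ) (e : Vertex F n), ContinuousOn (ray e) (Set.Iic ((k : ℝ) + 1)) := by
    intro k
    induction k with
    | zero =>
      intro e
      refine ((continuous_edge e).comp (continuous_projIcc (h := zero_le_one))).continuousOn.congr
        fun s hs => ray_of_le_one e (by simpa using hs)
    | succ k ih =>
      intro e
      have h1 : ContinuousOn (ray e) (Set.Iic 1) :=
        ((continuous_edge e).comp (continuous_projIcc (h := zero_le_one))).continuousOn.congr
          fun s hs => ray_of_le_one e hs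
      have h2 : ContinuousOn (ray e) (Set.Icc 1 ((k : ℝ) + 1 + 1)) := by
        have h3 : ContinuousOn (fun s : ℝ => ray e.up (s - 1)) (Set.Icc 1 ((k : ℝ) + 1 + 1)) :=
          (ih e.up).comp (by fun_prop) fun s hs => by
            have := hs.2
            simp only [Set.mem_Iic]; linarith
        refine h3.congr fun s hs => ?_
        show ray e s = ray e.up (s - 1)
        rw [← ray_add_one _ (sub_nonneg.2 hs.1), sub_add_cancel]
      refine (h1.union_of_isClosed h2 isClosed_Iic isClosed_Icc).mono fun s hs => ?_
      rcases le_total s 1 with h | h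
      · exact Or.inl h
      · exact Or.inr ⟨h, by simpa using hs⟩
  refine continuous_iff_continuousAt.2 fun s => ?_
  refine (key ⌈s⌉₊ e).continuousAt (Iic_mem_nhds ?_)
  exact (Nat.le_ceil s).trans_lt (lt_add_one _)

/-- Move a point upwards by the distance `s`; nothing moves for negative `s`. -/
def flow (x : Tree F n) (s : ℝ) : Tree F n :=
  lift (fun e t => ray e (t + max s 0)) (fun e => by
    simp only [Set.Icc.coe_one, Set.Icc.coe_zero, zero_add]
    rw [add_comm, ray_add_one _ (le_max_right _ _)]) x

theorem flow_edge (e : Vertex F n) (t : I) {s : ℝ} (hs : 0 ≤ s) :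
    flow (edge e t) s = ray e (t + s) := by
  rw [flow, lift_edge, max_eq_left hs]

theorem continuous_flow : Continuous fun p : Tree F n × ℝ => flow p.1 p.2 :=
  continuous_prod_of_edge fun e => (continuous_ray e).comp (by fun_prop)

@[fun_prop]
theorem _root_.Continuous.treeFlow {A : Type*} [TopologicalSpace A] {f : A → Tree F n}
    {g : A → ℝ} (hf : Continuous f) (hg : Continuous g) : Continuous fun a => flow (f a) (g a) :=
  continuous_flow.comp (hf.prodMk hg)

theorem flow_ray (e : Vertex F n) {r s : ℝ} (hr : 0 ≤ r) (hs : 0 ≤ s) :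
    flow (ray e r) s = ray e (r + s) := by
  have h0 := Nat.floor_le hr
  have h1 := Nat.lt_floor_add_one r
  rw [ray, flow_edge _ _ hs, ← ray_add_nat _ (add_nonneg (Set.projIcc 0 1 _ _).2.1 hs),
    Set.projIcc_of_mem zero_le_one ⟨by linarith, by linarith⟩]
  congr 1
  ring

theorem flow_add (x : Tree F n) {r s : ℝ} (hr : 0 ≤ r) (hs : 0 ≤ s) :
    flow (flow x r) s = flow x (r + s) := by
  obtain ⟨e, t, rfl⟩ := exists_edge x
  rw [flow_edge _ _ hr, flow_ray _ (add_nonneg t.2.1 hr) hs, flow_edge _ _ (add_nonneg hr hs),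
    add_assoc]

theorem flow_zero (x : Tree F n) : flow x 0 = x := by
  obtain ⟨e, t, rfl⟩ := exists_edge x
  rw [flow_edge _ _ le_rfl, add_zero, ray_coe]

theorem map_ray (g : Vertex F n → Vertex F n) (hg : ∀ v, g v.up = (g v).up) (e : Vertex F n)
    (s : ℝ) : Tree.map g hg (ray e s) = ray (g e) s := by
  have : ∀ k : ℕ, g (Vertex.up^[k] e) = Vertex.up^[k] (g e) := fun k =>
    (Function.Semiconj.iterate_right (show Function.Semiconj g Vertex.up Vertex.up from hg) k) e
  rw [ray, ray, map_edge, this]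

theorem map_flow (g : Vertex F n → Vertex F n) (hg : ∀ v, g v.up = (g v).up) (x : Tree F n)
    (s : ℝ) : Tree.map g hg (flow x s) = flow (Tree.map g hg x) s := by
  obtain ⟨e, t, rfl⟩ := exists_edge x
  exact map_ray g hg e _

theorem glue_flow (j : Fin n) (x : Tree F n) (s : ℝ) :
    (flow x s).glue j = flow (x.glue j) s := map_flow _ _ x s

theorem smul_flow (f : Base F n) (x : Tree F n) (s : ℝ) : f • flow x s = flow (f • x) s :=
  map_flow _ _ x s

theorem smul_ray (f : Base F n) (e : Vertex F n) (s : ℝ) : f • ray e s = ray (f • e) s :=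
  map_ray _ _ e s

end Tree

/-! ### Contracting the tree to a vertex -/

/-- The vertex `b Bₖ`. -/
def Vertex.coset (k : ℕ+) (b : Base F n) : Vertex F n := ⟨k, QuotientGroup.mk b⟩

theorem Vertex.exists_coset (v : Vertex F n) : ∃ b, v = Vertex.coset v.1 b := by
  obtain ⟨k, q⟩ := v
  obtain ⟨b, rfl⟩ := QuotientGroup.mk_surjective q
  exact ⟨b, rfl⟩

theorem Vertex.coset_eq_coset {k : ℕ+} {b c : Base F n} :
    Vertex.coset k b = Vertex.coset k c ↔ b⁻¹ * c ∈ ballSubgroup F n k := by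
  rw [← QuotientGroup.eq]
  constructor
  · intro h
    exact eq_of_heq (Sigma.mk.inj h).2
  · intro h
    rw [Vertex.coset, h]; rfl

theorem Vertex.up_coset (k : ℕ+) (b : Base F n) :
    (Vertex.coset k b).up = Vertex.coset (k + 1) b := rfl

theorem Vertex.smul_coset (f : Base F n) (k : ℕ+) (b : Base F n) :
    f • Vertex.coset k b = Vertex.coset k (f * b) := rfl

theorem Vertex.iterate_up_fst (i : ℕ) (v : Vertex F n) :
    ((Vertex.up^[i] v).1 : ℕ) = v.1 + i := by
  induction i generalizing v with
  | zero => simp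
  | succ i ih =>
    rw [Function.iterate_succ_apply, ih]
    simp only [Vertex.up, PNat.add_coe, PNat.one_coe]
    ring

theorem Vertex.iterate_up_coset (i : ℕ) (k : ℕ+) (b : Base F n) :
    Vertex.up^[i] (Vertex.coset k b) = Vertex.coset ⟨k + i, by positivity⟩ b := by
  induction i generalizing k with
  | zero => rfl
  | succ i ih =>
    rw [Function.iterate_succ_apply, Vertex.up_coset, ih]
    congr 1
    apply PNat.eq
    simp only [PNat.add_coe, PNat.one_coe, PNat.mk_coe]
    ring

/-- A finitely supported function is supported in some ball. -/
theorem exists_mem_ballSubgroup (b : Base F n) : ∃ k, b ∈ ballSubgroup F n k := by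
  obtain ⟨k, hk⟩ := (b.2.image FreeGroup.norm).bddAbove
  exact ⟨k, fun w hw => hk ⟨w, hw, rfl⟩⟩

/-- Any two ascending rays merge. -/
theorem Vertex.exists_iterate_up_eq (v₀ v : Vertex F n) :
    ∃ i j, Vertex.up^[i] v = Vertex.up^[j] v₀ := by
  obtain ⟨b₀, h₀⟩ := v₀.exists_coset
  obtain ⟨b, h⟩ := v.exists_coset
  obtain ⟨k, hk⟩ := exists_mem_ballSubgroup (b⁻¹ * b₀)
  refine ⟨v₀.1 + k, v.1 + k, ?_⟩
  rw [h, h₀, Vertex.iterate_up_coset, Vertex.iterate_up_coset]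
  have e : (⟨v.1 + (v₀.1 + k), by positivity⟩ : ℕ+) = ⟨v₀.1 + (v.1 + k), by positivity⟩ := by
    apply PNat.eq; simp only [PNat.mk_coe]; ring
  refine Eq.trans (congrArg (fun k => Vertex.coset k b) e) (Vertex.coset_eq_coset.2 ?_)
  exact ballSubgroup_mono F n (show k ≤ v₀.1 + (v.1 + k) by omega) hk

open Classical in
/-- The number of edges that the ascending ray from `v` traverses before it meets the ascending
ray from `v₀`. -/
def Vertex.mergeSteps (v₀ v : Vertex F n) : ℕ := Nat.find (v₀.exists_iterate_up_eq v)

theorem Vertex.mergeSteps_spec (v₀ v : Vertex F n) :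
    ∃ j, Vertex.up^[v₀.mergeSteps v] v = Vertex.up^[j] v₀ := by
  classical exact Nat.find_spec (v₀.exists_iterate_up_eq v)

theorem Vertex.mergeSteps_le {v₀ v : Vertex F n} {i j : ℕ}
    (h : Vertex.up^[i] v = Vertex.up^[j] v₀) : v₀.mergeSteps v ≤ i := by
  classical exact Nat.find_min' _ ⟨j, h⟩

theorem Vertex.mergeSteps_up (v₀ v : Vertex F n) :
    v₀.mergeSteps v.up = v₀.mergeSteps v - 1 := by
  obtain ⟨j, hj⟩ := v₀.mergeSteps_spec v
  obtain ⟨j', hj'⟩ := v₀.mergeSteps_spec v.up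
  rw [← Function.iterate_succ_apply] at hj'
  have h1 := Vertex.mergeSteps_le hj'
  rcases h : v₀.mergeSteps v with - | m
  · rw [h] at hj
    have : Vertex.up^[0] v.up = Vertex.up^[j + 1] v₀ := by
      rw [Function.iterate_succ_apply', ← hj]; rfl
    exact Nat.le_zero.1 (Vertex.mergeSteps_le this)
  · rw [h, Function.iterate_succ_apply] at hj
    have := Vertex.mergeSteps_le hj
    omega

namespace Tree

/-- The distance which a point has to move upwards to meet the ascending ray from `v₀`. It
decreases with slope `1` along the edges until the ray is met; on the ray it is `0`. -/
def mergeDist (v₀ : Vertex F n) : Tree F n → ℝ :=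
  lift (fun e t => max (v₀.mergeSteps e - t : ℝ) 0) (fun e => by
    rw [Vertex.mergeSteps_up]
    rcases h : v₀.mergeSteps e with - | m
    · simp
    · simp)

theorem mergeDist_nonneg (v₀ : Vertex F n) (x : Tree F n) : 0 ≤ mergeDist v₀ x := by
  obtain ⟨e, t, rfl⟩ := exists_edge x
  exact le_max_right _ _

@[fun_prop]
theorem continuous_mergeDist (v₀ : Vertex F n) : Continuous (mergeDist v₀) :=
  continuous_of_edge fun e => by simp only [mergeDist, lift_edge]; fun_prop

/-- The height function, equal to `k` at the vertex `b Bₖ`. -/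
def height : Tree F n → ℝ :=
  lift (fun e t => (e.1 : ℕ) + (t : ℝ)) (fun e => by simp [Vertex.up])

@[fun_prop]
theorem continuous_height : Continuous (height (F := F) (n := n)) :=
  continuous_of_edge fun e => by simp only [height, lift_edge]; fun_prop

/-- The distance from `v₀` to the point where the ascending rays from `v₀` and `x` merge. -/
def baseDist (v₀ : Vertex F n) (x : Tree F n) : ℝ := mergeDist v₀ x + height x - (v₀.1 : ℕ)

theorem flow_mergeDist (v₀ : Vertex F n) (x : Tree F n) :
    flow x (mergeDist v₀ x) = ray v₀ (baseDist v₀ x) := by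
  have h0 := mergeDist_nonneg v₀ x
  obtain ⟨e, t, rfl⟩ := exists_edge x
  have ht := t.2.2
  obtain ⟨j, hj⟩ := v₀.mergeSteps_spec e
  have hk := congrArg (fun v : Vertex F n => (v.1 : ℕ)) hj
  simp only [Vertex.iterate_up_fst] at hk
  have hk' : ((e.1 : ℕ) : ℝ) + v₀.mergeSteps e = (v₀.1 : ℕ) + j := by exact_mod_cast hk
  rw [flow_edge _ _ h0]
  simp only [baseDist, mergeDist, height, lift_edge]
  rcases h : v₀.mergeSteps e with - | m
  · rw [h] at hj hk'
    have ht0 := t.2.1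
    have h1 : max ((0 : ℕ) - (t : ℝ)) 0 = 0 := max_eq_right (by simpa using ht0)
    simp only [Nat.cast_zero, add_zero, Function.iterate_zero, id_eq] at hk' hj
    rw [h1, hj, add_zero, ← ray_add_nat _ t.2.1, zero_add, ← hj, hk']
    congr 1
    ring
  · have h1 : max (((m + 1 : ℕ) : ℝ) - (t : ℝ)) 0 = ((m + 1 : ℕ) : ℝ) - (t : ℝ) := by
      apply max_eq_left
      push_cast
      have : (0 : ℝ) ≤ m := by positivity
      linarith
    rw [h] at hj hk'
    rw [h1, add_sub_cancel]
    have h2 := ray_add_nat e le_rfl (m + 1)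
    have h3 := ray_add_nat v₀ le_rfl j
    rw [zero_add] at h2 h3
    rw [h2, hj, ← h3]
    congr 1
    linarith

end Tree

/-- A homotopy that carries a subset `S` into a subset `S'` at all times restricts to these. -/
theorem homotopic_restrict {X Y : Type*} [TopologicalSpace X] [TopologicalSpace Y] {S : Set X}
    {S' : Set Y} (G : X × I → Y) (hG : Continuous G) (hS : ∀ x ∈ S, ∀ t, G (x, t) ∈ S')
    {f₀ f₁ : C(S, S')} (h₀ : ∀ x, (f₀ x : Y) = G (x, 0)) (h₁ : ∀ x, (f₁ x : Y) = G (x, 1)) :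
    f₀.Homotopic f₁ :=
  ⟨{ toFun := fun p => ⟨G (p.2, p.1), hS _ p.2.2 _⟩
     continuous_toFun := by fun_prop
     map_zero_left := fun x => Subtype.ext (h₀ x).symm
     map_one_left := fun x => Subtype.ext (h₁ x).symm }⟩

/-- If some vertex is fixed by `S ⊆ B`, then the set of fixed points of `S` in the tree is
contractible. Points first move up to the ascending ray from that vertex, and then down
along this ray. -/
theorem Tree.contractible_fixed (S : Set (Base F n)) (v₀ : Vertex F n)
    (hS : ∀ f ∈ S, f • v₀ = v₀) :
    ContractibleSpace {x : Tree F n | ∀ f ∈ S, f • x = x} := by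
  rw [contractible_iff_id_nullhomotopic]
  have hv : Tree.vert v₀ ∈ {x : Tree F n | ∀ f ∈ S, f • x = x} := fun f hf => by
    rw [Tree.smul_vert, hS f hf]
  have c1 : Continuous fun p : Tree F n × I => Tree.flow p.1 (p.2 * Tree.mergeDist v₀ p.1) := by
    fun_prop
  have c2 : Continuous fun p : Tree F n × I => Tree.ray v₀ ((1 - p.2) * Tree.baseDist v₀ p.1) := by
    unfold Tree.baseDist
    fun_prop
  have m1 : ∀ x ∈ {x : Tree F n | ∀ f ∈ S, f • x = x}, ∀ t : I,
      Tree.flow x (t * Tree.mergeDist v₀ x) ∈ {x : Tree F n | ∀ f ∈ S, f • x = x} :=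
    fun x hx t f hf => by rw [Tree.smul_flow, hx f hf]
  have m2 : ∀ x ∈ {x : Tree F n | ∀ f ∈ S, f • x = x}, ∀ t : I,
      Tree.ray v₀ ((1 - t) * Tree.baseDist v₀ x) ∈ {x : Tree F n | ∀ f ∈ S, f • x = x} :=
    fun x hx t f hf => by rw [Tree.smul_ray, hS f hf]
  refine ⟨⟨_, hv⟩, ContinuousMap.Homotopic.trans (g := ⟨fun x => ⟨_, m1 x x.2 1⟩, ?_⟩)
    (homotopic_restrict _ c1 m1 (fun x => ?_) fun x => ?_)
    (homotopic_restrict _ c2 m2 (fun x => ?_) fun x => ?_)⟩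
  · exact (c1.comp (continuous_subtype_val.prodMk continuous_const)).subtype_mk _
  · simp [Tree.flow_zero]
  · simp
  · simp [Tree.flow_mergeDist]
  · simp [Tree.ray_zero]

/-! ### The homotopy inverses of the gluing maps -/

theorem shift_of_mem (F : Type u) [Group F] (n k : ℕ) (j : Fin n) {f : Base F n}
    (hf : f ∈ ballSubgroup F n k) :
    shift F n (FreeGroup.of j) f ∈ ballSubgroup F n (k + 1) := by
  intro w hw
  rw [shift_apply] at hw
  have h1 : ((FreeGroup.of j)⁻¹ * w).norm ≤ k := hf _ hw
  have h2 := FreeGroup.norm_mul_le (FreeGroup.of j) ((FreeGroup.of j)⁻¹ * w)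
  rw [mul_inv_cancel_left, FreeGroup.norm_of] at h2
  omega

/-- The map `b Bₖ ↦ (aⱼ · b) Bₖ₊₁` in the direction opposite to the gluing map. -/
def Vertex.coglue (j : Fin n) (v : Vertex F n) : Vertex F n :=
  ⟨v.1 + 1, Quotient.map' (shift F n (FreeGroup.of j)) (fun a b h => by
    rw [QuotientGroup.leftRel_apply] at h ⊢
    rw [← map_inv, ← map_mul]
    exact shift_of_mem F n _ j h) v.2⟩

theorem Vertex.glue_coset (j : Fin n) (k : ℕ+) (b : Base F n) :
    (Vertex.coset k b).glue j = Vertex.coset (k + 1) (shift F n (FreeGroup.of j)⁻¹ b) := rfl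

theorem Vertex.coglue_coset (j : Fin n) (k : ℕ+) (b : Base F n) :
    (Vertex.coset k b).coglue j = Vertex.coset (k + 1) (shift F n (FreeGroup.of j) b) := rfl

theorem Vertex.up_coglue (j : Fin n) (v : Vertex F n) : v.up.coglue j = (v.coglue j).up := by
  obtain ⟨b, h⟩ := v.exists_coset
  rw [h]
  rfl

theorem Vertex.coglue_glue (j : Fin n) (v : Vertex F n) : (v.glue j).coglue j = v.up.up := by
  obtain ⟨b, h⟩ := v.exists_coset
  rw [h, glue_coset, coglue_coset, ← MulAut.mul_apply, ← map_mul, mul_inv_cancel, map_one]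
  rfl

theorem Vertex.glue_coglue (j : Fin n) (v : Vertex F n) : (v.coglue j).glue j = v.up.up := by
  obtain ⟨b, h⟩ := v.exists_coset
  rw [h, coglue_coset, glue_coset, ← MulAut.mul_apply, ← map_mul, inv_mul_cancel, map_one]
  rfl

theorem Vertex.coglue_smul (j : Fin n) (f : Base F n) (v : Vertex F n) :
    (f • v).coglue j = shift F n (FreeGroup.of j) f • v.coglue j := by
  obtain ⟨b, h⟩ := v.exists_coset
  rw [h, smul_coset, coglue_coset, coglue_coset, smul_coset, map_mul]

namespace Tree

/-- The map `T_{w aⱼ} → T_w`, `b Bₖ ↦ (aⱼ · b) Bₖ₊₁`. Up to the flow it is inverse to the gluing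
map. -/
def coglue (j : Fin n) : Tree F n → Tree F n := Tree.map (Vertex.coglue j) (Vertex.up_coglue j)

@[fun_prop]
theorem continuous_coglue (j : Fin n) : Continuous (coglue (F := F) j) := continuous_map _ _

theorem flow_two_edge (e : Vertex F n) (t : I) : flow (edge e t) 2 = edge e.up.up t := by
  rw [flow_edge _ _ zero_le_two, ← ray_coe e.up.up]
  exact_mod_cast ray_add_nat e t.2.1 2

theorem coglue_glue (j : Fin n) (x : Tree F n) : (x.glue j).coglue j = flow x 2 := by
  obtain ⟨e, t, rfl⟩ := exists_edge x
  rw [flow_two_edge, ← Vertex.coglue_glue j]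
  rfl

theorem glue_coglue (j : Fin n) (x : Tree F n) : (x.coglue j).glue j = flow x 2 := by
  obtain ⟨e, t, rfl⟩ := exists_edge x
  rw [flow_two_edge, ← Vertex.glue_coglue j]
  rfl

theorem coglue_smul (j : Fin n) (f : Base F n) (x : Tree F n) :
    coglue j (f • x) = shift F n (FreeGroup.of j) f • coglue j x := by
  obtain ⟨e, t, rfl⟩ := exists_edge x
  exact congrArg (fun e => edge e t) (Vertex.coglue_smul j f e)

end Tree

theorem coglue_twist (w : FreeGroup (Fin n)) (j : Fin n) (f : Base F n) (x : Tree F n) :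
    Tree.coglue j (twist (w * FreeGroup.of j) f x) = twist w f (Tree.coglue j x) := by
  rw [twist, twist, Tree.coglue_smul, mul_inv_rev, map_mul, MulAut.mul_apply, ← MulAut.mul_apply,
    ← map_mul, mul_inv_cancel, map_one, MulAut.one_apply]

theorem twist_flow (w : FreeGroup (Fin n)) (f : Base F n) (x : Tree F n) (s : ℝ) :
    twist w f (x.flow s) = (twist w f x).flow s := Tree.smul_flow _ _ _

/-! ### Points of the telescope and continuity of maps out of it -/

namespace Telescope

/-- The point `x` of the copy `T_w` of the tree. -/
def vert (w : FreeGroup (Fin n)) (x : Tree F n) : Telescope F n := Quot.mk _ (Sum.inl ⟨w, x⟩)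

/-- The point `(x, t)` of `T_w × [w, w aⱼ]`. -/
def edge (w : FreeGroup (Fin n)) (j : Fin n) (x : Tree F n) (t : I) : Telescope F n :=
  Quot.mk _ (Sum.inr ⟨(w, j), (x, t)⟩)

theorem edge_zero (w : FreeGroup (Fin n)) (j : Fin n) (x : Tree F n) :
    edge w j x 0 = vert w x := Quot.sound (TelescopeRel.source w j x)

theorem edge_one (w : FreeGroup (Fin n)) (j : Fin n) (x : Tree F n) :
    edge w j x 1 = vert (w * FreeGroup.of j) (x.glue j) := Quot.sound (TelescopeRel.target w j x)

@[fun_prop]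
theorem continuous_vert (w : FreeGroup (Fin n)) : Continuous (vert (F := F) w) :=
  continuous_quot_mk.comp (continuous_inl.comp continuous_sigmaMk)

theorem continuous_edge (w : FreeGroup (Fin n)) (j : Fin n) :
    Continuous fun p : Tree F n × I => edge w j p.1 p.2 :=
  have h : Continuous fun p : Tree F n × I =>
      (⟨(w, j), p⟩ : Σ _ : FreeGroup (Fin n) × Fin n, Tree F n × I) :=
    @continuous_sigmaMk (FreeGroup (Fin n) × Fin n) (fun _ => Tree F n × I) _ (w, j)
  continuous_quot_mk.comp (continuous_inr.comp h)

@[fun_prop]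
theorem _root_.Continuous.telescopeEdge {A : Type*} [TopologicalSpace A] {f : A → Tree F n}
    {g : A → I} (hf : Continuous f) (hg : Continuous g) (w : FreeGroup (Fin n)) (j : Fin n) :
    Continuous fun a => edge w j (f a) (g a) :=
  (continuous_edge w j).comp (hf.prodMk hg)

@[elab_as_elim]
theorem cases_pieces {motive : Telescope F n → Prop} (hv : ∀ w x, motive (vert w x))
    (he : ∀ w j x t, motive (edge w j x t)) (z : Telescope F n) : motive z := by
  obtain ⟨⟨w, x⟩ | ⟨⟨w, j⟩, ⟨x, t⟩⟩⟩ := z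
  · exact hv w x
  · exact he w j x t

theorem smul_vert (γ : Wreath F n) (w : FreeGroup (Fin n)) (x : Tree F n) :
    γ • vert w x = vert (γ.right * w) (twist (γ.right * w) γ.left x) := rfl

theorem smul_edge (γ : Wreath F n) (w : FreeGroup (Fin n)) (j : Fin n) (x : Tree F n) (t : I) :
    γ • edge w j x t = edge (γ.right * w) j (twist (γ.right * w) γ.left x) t := rfl

theorem inl_smul_vert (f : Base F n) (w : FreeGroup (Fin n)) (x : Tree F n) :
    (SemidirectProduct.inl f : Wreath F n) • vert w x = vert w (twist w f x) := by
  simp [smul_vert]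

theorem inl_smul_edge (f : Base F n) (w : FreeGroup (Fin n)) (j : Fin n) (x : Tree F n) (t : I) :
    (SemidirectProduct.inl f : Wreath F n) • edge w j x t = edge w j (twist w f x) t := by
  simp [smul_edge]

theorem continuous_of_pieces {Y : Type*} [TopologicalSpace Y] {f : Telescope F n → Y}
    (hv : ∀ w, Continuous fun x => f (vert w x))
    (he : ∀ w j, Continuous fun p : Tree F n × I => f (edge w j p.1 p.2)) : Continuous f :=
  continuous_coinduced_dom.2 (continuous_sum_dom.2
    ⟨continuous_sigma_iff.2 hv, continuous_sigma_iff.2 fun p => he p.1 p.2⟩)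

theorem continuous_prod_of_pieces {A Y : Type*} [TopologicalSpace A] [LocallyCompactSpace A]
    [TopologicalSpace Y] {f : Telescope F n × A → Y}
    (hv : ∀ w, Continuous fun p : Tree F n × A => f (vert w p.1, p.2))
    (he : ∀ w j, Continuous fun p : (Tree F n × I) × A => f (edge w j p.1.1 p.1.2, p.2)) :
    Continuous f := by
  have h1 : ∀ z, Continuous fun a => f (z, a) :=
    fun z => cases_pieces (fun w x => (hv w).comp (Continuous.prodMk_right x))
      (fun w j x t => (he w j).comp (Continuous.prodMk_right (x, t))) z
  let g : Telescope F n → C(A, Y) := fun z => ⟨fun a => f (z, a), h1 z⟩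
  have hg : Continuous g := continuous_of_pieces
    (fun w => ContinuousMap.continuous_of_continuous_uncurry _ (hv w))
    fun w j => ContinuousMap.continuous_of_continuous_uncurry _ (he w j)
  exact ContinuousMap.continuous_uncurry_of_continuous ⟨g, hg⟩

/-- The map given by `φ w` on `T_w` and by `ψ w j` on `T_w × [w, w aⱼ]`. -/
def lift {Y : Type*} (φ : FreeGroup (Fin n) → Tree F n → Y)
    (ψ : FreeGroup (Fin n) → Fin n → Tree F n → I → Y) (h₀ : ∀ w j x, ψ w j x 0 = φ w x)
    (h₁ : ∀ w j x, ψ w j x 1 = φ (w * FreeGroup.of j) (x.glue j)) : Telescope F n → Y :=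
  Quot.lift (Sum.elim (fun p => φ p.1 p.2) fun p => ψ p.1.1 p.1.2 p.2.1 p.2.2) (by
    rintro _ _ (⟨w, j, x⟩ | ⟨w, j, x⟩)
    · exact h₀ w j x
    · exact h₁ w j x)

section lift

variable {Y : Type*} (φ : FreeGroup (Fin n) → Tree F n → Y)
  (ψ : FreeGroup (Fin n) → Fin n → Tree F n → I → Y) (h₀ : ∀ w j x, ψ w j x 0 = φ w x)
  (h₁ : ∀ w j x, ψ w j x 1 = φ (w * FreeGroup.of j) (x.glue j))

theorem lift_vert (w : FreeGroup (Fin n)) (x : Tree F n) :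
    lift φ ψ h₀ h₁ (vert w x) = φ w x := rfl

theorem lift_edge (w : FreeGroup (Fin n)) (j : Fin n) (x : Tree F n) (t : I) :
    lift φ ψ h₀ h₁ (edge w j x t) = ψ w j x t := rfl

end lift

/-! ### Paths from the identity in the Cayley graph -/

/-- The vertex of the Cayley graph that a word describes. The head of the word is the last step of
the path from `1`; the letter `(j, false)` stands for the step from `w` to `w aⱼ` and `(j, true)`
for the reverse step. -/
def wordVal (l : List (Fin n × Bool)) : FreeGroup (Fin n) := (FreeGroup.mk l)⁻¹

theorem wordVal_false (j : Fin n) (l : List (Fin n × Bool)) :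
    wordVal ((j, false) :: l) = wordVal l * FreeGroup.of j := by
  have : FreeGroup.mk ((j, false) :: l) = (FreeGroup.of j)⁻¹ * FreeGroup.mk l := rfl
  rw [wordVal, this, mul_inv_rev, inv_inv, wordVal]

theorem wordVal_true (j : Fin n) (l : List (Fin n × Bool)) :
    wordVal ((j, true) :: l) * FreeGroup.of j = wordVal l := by
  have : FreeGroup.mk ((j, true) :: l) = FreeGroup.of j * FreeGroup.mk l := rfl
  rw [wordVal, this, mul_inv_rev, inv_mul_cancel_right, wordVal]

/-- The word of the geodesic from `1` to `w`. -/
def word (w : FreeGroup (Fin n)) : List (Fin n × Bool) := w⁻¹.toWord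

theorem wordVal_word (w : FreeGroup (Fin n)) : wordVal (word w) = w := by
  rw [wordVal, word, FreeGroup.mk_toWord, inv_inv]

/-- The edge `[w, w aⱼ]` points away from `1`. -/
def Away (w : FreeGroup (Fin n)) (j : Fin n) : Prop :=
  word (w * FreeGroup.of j) = (j, false) :: word w

/-- The Cayley graph is a tree: every edge is the last step of the geodesic to one of its ends. -/
theorem word_of_not_away {w : FreeGroup (Fin n)} {j : Fin n} (h : ¬ Away w j) :
    word w = (j, true) :: word (w * FreeGroup.of j) := by
  have h1 : word (w * FreeGroup.of j) = FreeGroup.reduce ((j, false) :: word w) := by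
    rw [word, mul_inv_rev, ← FreeGroup.toWord_mk]
    conv_lhs => rw [← FreeGroup.mk_toWord (x := w⁻¹)]
    rfl
  have h2 : FreeGroup.reduce (word w) = word w := FreeGroup.reduce_toWord _
  rw [Away, h1, FreeGroup.reduce.cons, h2] at h
  rw [h1, FreeGroup.reduce.cons, h2]
  rcases hw : word w with - | ⟨⟨i, b⟩, l⟩
  · rw [hw] at h; exact absurd rfl h
  · rw [hw] at h
    simp only at h ⊢
    split_ifs at h with hc
    · obtain ⟨rfl, hb⟩ := hc
      cases b
      · simp at hb
      · simp
    · exact absurd rfl h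

/-- The number of steps along the orientation of the edges. -/
def steps : List (Fin n × Bool) → ℕ
  | [] => 0
  | (_, false) :: l => steps l + 1
  | (_, true) :: l => steps l

/-! ### Lifting the geodesics to the telescope -/

/-- A lift of the path of a word `l` to the telescope. If `w` is the value of `l` and
`x ∈ T_w`, it leads from a point of `T_1` at time `0` to the point of `T_w` at distance
`2 * steps l` above `x` at time `|l|`. Gluing after `coglue` is the flow by `2`, so this distance
is what is needed to trace the path back over every positively oriented step. -/
def path : List (Fin n × Bool) → Tree F n → ℝ → Telescope F n
  | [], x, _ => vert 1 x
  | (j, false) :: l, x, d => if d ≤ l.length then path l (x.coglue j) d else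
      edge (wordVal l) j ((x.coglue j).flow (2 * steps l))
        (Set.projIcc 0 1 zero_le_one (d - l.length))
  | (j, true) :: l, x, d => if d ≤ l.length then path l (x.glue j) d else
      edge (wordVal ((j, true) :: l)) j (x.flow (2 * steps l))
        (Set.projIcc 0 1 zero_le_one (1 - (d - l.length)))

/-- The path `path l x`, continued into the piece over the edge from `w` to `w aⱼ`, where `w` is
the value of `l`. -/
def pathExt (l : List (Fin n × Bool)) (j : Fin n) (x : Tree F n) (d : ℝ) : Telescope F n :=
  if d ≤ l.length then path l x d else
    edge (wordVal l) j (x.flow (2 * steps l)) (Set.projIcc 0 1 zero_le_one (d - l.length))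

theorem path_false (j : Fin n) (l : List (Fin n × Bool)) (x : Tree F n) (d : ℝ) :
    path ((j, false) :: l) x d = pathExt l j (x.coglue j) d := rfl

theorem path_length (l : List (Fin n × Bool)) (x : Tree F n) :
    path l x l.length = vert (wordVal l) (x.flow (2 * steps l)) := by
  rcases l with - | ⟨⟨j, b⟩, l⟩
  · simp [path, wordVal, steps, Tree.flow_zero, ← FreeGroup.one_eq_mk]
  · have h : ¬ (((j, b) :: l).length : ℝ) ≤ l.length := by simp
    cases b
    · rw [path, if_neg h, wordVal_false, steps]
      simp only [List.length_cons, Nat.cast_add, Nat.cast_one, add_sub_cancel_left,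
        Set.projIcc_right]
      exact (edge_one _ _ _).trans (by
        rw [Tree.glue_flow, Tree.glue_coglue, Tree.flow_add _ zero_le_two (by positivity)]
        ring_nf)
    · rw [path, if_neg h, steps]
      simp only [List.length_cons, Nat.cast_add, Nat.cast_one, add_sub_cancel_left,
        sub_self, Set.projIcc_left]
      exact edge_zero _ _ _

theorem pathExt_of_le (l : List (Fin n × Bool)) (j : Fin n) (x : Tree F n) {d : ℝ}
    (h : d ≤ l.length) : pathExt l j x d = path l x d := if_pos h

theorem pathExt_of_ge (l : List (Fin n × Bool)) (j : Fin n) (x : Tree F n) {d : ℝ}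
    (h : l.length ≤ d) : pathExt l j x d =
      edge (wordVal l) j (x.flow (2 * steps l)) (Set.projIcc 0 1 zero_le_one (d - l.length)) := by
  rcases h.eq_or_lt with rfl | h
  · rw [pathExt_of_le _ _ _ le_rfl, path_length, sub_self, Set.projIcc_left]
    exact (edge_zero _ _ _).symm
  · exact if_neg h.not_ge

theorem path_true_of_le (l : List (Fin n × Bool)) (j : Fin n) (x : Tree F n) {d : ℝ}
    (h : d ≤ l.length) : path ((j, true) :: l) x d = path l (x.glue j) d := if_pos h

theorem path_true_of_ge (l : List (Fin n × Bool)) (j : Fin n) (x : Tree F n) {d : ℝ}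
    (h : l.length ≤ d) : path ((j, true) :: l) x d =
      edge (wordVal ((j, true) :: l)) j (x.flow (2 * steps l))
        (Set.projIcc 0 1 zero_le_one (1 - (d - l.length))) := by
  rcases h.eq_or_lt with rfl | h
  · rw [path_true_of_le _ _ _ le_rfl, path_length, sub_self, sub_zero, Set.projIcc_right,
      ← Tree.glue_flow, ← wordVal_true j]
    exact (edge_one _ _ _).symm
  · exact if_neg h.not_ge

theorem continuous_pathExt (l : List (Fin n × Bool)) (j : Fin n)
    (hl : Continuous fun p : Tree F n × ℝ => path l p.1 p.2) :
    Continuous fun p : Tree F n × ℝ => pathExt l j p.1 p.2 := by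
  refine Continuous.if_le hl ?_ continuous_snd continuous_const fun p hp => ?_
  · have := continuous_projIcc (α := ℝ) (h := zero_le_one)
    fun_prop
  · rw [← pathExt_of_ge _ _ _ hp.ge, pathExt_of_le _ _ _ hp.le]

theorem continuous_path (l : List (Fin n × Bool)) :
    Continuous fun p : Tree F n × ℝ => path l p.1 p.2 := by
  induction l with
  | nil => exact (continuous_vert 1).comp continuous_fst
  | cons c l ih =>
    obtain ⟨j, b⟩ := c
    cases b
    · exact (continuous_pathExt l j ih).comp
        (((Tree.continuous_coglue j).comp continuous_fst).prodMk continuous_snd)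
    · refine Continuous.if_le
        (ih.comp (((Tree.continuous_glue j).comp continuous_fst).prodMk continuous_snd))
        ?_ continuous_snd continuous_const fun p hp => ?_
      · have := continuous_projIcc (α := ℝ) (h := zero_le_one)
        fun_prop
      · rw [← path_true_of_ge _ _ _ hp.ge, path_true_of_le _ _ _ hp.le]

@[fun_prop]
theorem _root_.Continuous.telescopePath {A : Type*} [TopologicalSpace A] {f : A → Tree F n}
    {g : A → ℝ} (hf : Continuous f) (hg : Continuous g) (l : List (Fin n × Bool)) :
    Continuous fun a => path l (f a) (g a) :=
  (continuous_path l).comp (hf.prodMk hg)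

@[fun_prop]
theorem _root_.Continuous.telescopePathExt {A : Type*} [TopologicalSpace A] {f : A → Tree F n}
    {g : A → ℝ} (hf : Continuous f) (hg : Continuous g) (l : List (Fin n × Bool)) (j : Fin n) :
    Continuous fun a => pathExt l j (f a) (g a) :=
  (continuous_pathExt l j (continuous_path l)).comp (hf.prodMk hg)

theorem pathExt_twist (l : List (Fin n × Bool)) (j : Fin n) (f : Base F n) (x : Tree F n) (d : ℝ)
    (hl : path l (twist (wordVal l) f x) d = (SemidirectProduct.inl f : Wreath F n) • path l x d) :
    pathExt l j (twist (wordVal l) f x) d =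
      (SemidirectProduct.inl f : Wreath F n) • pathExt l j x d := by
  rcases le_total d l.length with h | h
  · rw [pathExt_of_le _ _ _ h, pathExt_of_le _ _ _ h, hl]
  · rw [pathExt_of_ge _ _ _ h, pathExt_of_ge _ _ _ h, inl_smul_edge, twist_flow]

theorem path_twist (l : List (Fin n × Bool)) (f : Base F n) (x : Tree F n) (d : ℝ) :
    path l (twist (wordVal l) f x) d =
      (SemidirectProduct.inl f : Wreath F n) • path l x d := by
  induction l generalizing x with
  | nil => simp [path, inl_smul_vert, wordVal, ← FreeGroup.one_eq_mk]
  | cons c l ih =>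
    obtain ⟨j, b⟩ := c
    cases b
    · rw [path_false, path_false, wordVal_false, coglue_twist, pathExt_twist _ _ _ _ _ (ih _)]
    · rcases le_total d l.length with h | h
      · rw [path_true_of_le _ _ _ h, path_true_of_le _ _ _ h, glue_twist, wordVal_true, ih]
      · rw [path_true_of_ge _ _ _ h, path_true_of_ge _ _ _ h, inl_smul_edge, twist_flow]

/-- The point of `T = T_1` at which `path l x` starts. -/
def pathStart : List (Fin n × Bool) → Tree F n → Tree F n
  | [], x => x
  | (j, false) :: l, x => pathStart l (x.coglue j)
  | (j, true) :: l, x => pathStart l (x.glue j)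

theorem path_zero (l : List (Fin n × Bool)) (x : Tree F n) :
    path l x 0 = vert 1 (pathStart l x) := by
  induction l generalizing x with
  | nil => rfl
  | cons c l ih =>
    have h : (0 : ℝ) ≤ l.length := by positivity
    obtain ⟨j, b⟩ := c
    cases b
    · rw [path_false, pathExt_of_le _ _ _ h, ih]; rfl
    · rw [path_true_of_le _ _ _ h, ih]; rfl

@[fun_prop]
theorem continuous_pathStart (l : List (Fin n × Bool)) :
    Continuous (pathStart (F := F) l) := by
  induction l with
  | nil => exact continuous_id
  | cons c l ih =>
    obtain ⟨j, b⟩ := c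
    cases b
    · exact ih.comp (Tree.continuous_coglue j)
    · exact ih.comp (Tree.continuous_glue j)

theorem pathStart_twist (l : List (Fin n × Bool)) (f : Base F n) (x : Tree F n) :
    pathStart l (twist (wordVal l) f x) = f • pathStart l x := by
  induction l generalizing x with
  | nil => simp [pathStart, wordVal, ← FreeGroup.one_eq_mk, twist]
  | cons c l ih =>
    obtain ⟨j, b⟩ := c
    cases b
    · simp only [pathStart]
      rw [wordVal_false, coglue_twist, ih]
    · simp only [pathStart]
      rw [glue_twist, wordVal_true, ih]

theorem path_word_twist (w : FreeGroup (Fin n)) (f : Base F n) (x : Tree F n) (d : ℝ) :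
    path (word w) (twist w f x) d =
      (SemidirectProduct.inl f : Wreath F n) • path (word w) x d := by
  have h := path_twist (word w) f x d
  rwa [wordVal_word] at h

theorem pathStart_word_twist (w : FreeGroup (Fin n)) (f : Base F n) (x : Tree F n) :
    pathStart (word w) (twist w f x) = f • pathStart (word w) x := by
  have h := pathStart_twist (word w) f x
  rwa [wordVal_word] at h

theorem pathExt_word_twist (w : FreeGroup (Fin n)) (j : Fin n) (f : Base F n) (x : Tree F n)
    (d : ℝ) : pathExt (word w) j (twist w f x) d =
      (SemidirectProduct.inl f : Wreath F n) • pathExt (word w) j x d := by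
  have h := pathExt_twist (word w) j f x d (path_twist _ _ _ _)
  rwa [wordVal_word] at h

/-! ### Deforming the telescope into one copy of the tree -/

theorem steps_word_mul_of_away {w : FreeGroup (Fin n)} {j : Fin n} (h : Away w j) :
    steps (word (w * FreeGroup.of j)) = steps (word w) + 1 := by
  rw [h, steps]

theorem steps_word_mul_of_not_away {w : FreeGroup (Fin n)} {j : Fin n} (h : ¬ Away w j) :
    steps (word (w * FreeGroup.of j)) = steps (word w) := by
  rw [word_of_not_away h, steps]

open Classical in
/-- The first homotopy: move up in the trees, by twice the number of positively oriented steps of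
the geodesic (interpolated linearly along the edges). This makes room for moving backwards over
the gluing maps. -/
def raise (z : Telescope F n) (s : ℝ) : Telescope F n :=
  lift (fun w x => vert w (x.flow (2 * steps (word w) * s)))
    (fun w j x t =>
      edge w j (x.flow (2 * (steps (word w) + if Away w j then (t : ℝ) else 0) * s)) t)
    (fun w j x => by simp [edge_zero])
    (fun w j x => by
      rw [edge_one, Tree.glue_flow]
      split_ifs with h
      · rw [steps_word_mul_of_away h]; simp
      · rw [steps_word_mul_of_not_away h]; simp) z

theorem continuous_raise : Continuous fun p : Telescope F n × I => raise p.1 p.2 := by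
  refine continuous_prod_of_pieces (fun w => ?_) fun w j => ?_
  · simp only [raise, lift_vert]
    fun_prop
  · simp only [raise, lift_edge]
    split_ifs <;> fun_prop

theorem raise_zero (z : Telescope F n) : raise z 0 = z := by
  induction z using cases_pieces with
  | hv w x =>
    simp only [raise, lift_vert, mul_zero, Tree.flow_zero]
  | he w j x t =>
    simp only [raise, lift_edge, mul_zero, Tree.flow_zero]

theorem raise_inl_smul (f : Base F n) (z : Telescope F n) (s : ℝ) :
    raise ((SemidirectProduct.inl f : Wreath F n) • z) s =
      (SemidirectProduct.inl f : Wreath F n) • raise z s := by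
  induction z using cases_pieces with
  | hv w x =>
    simp only [inl_smul_vert, raise, lift_vert, twist_flow]
  | he w j x t =>
    simp only [inl_smul_edge, raise, lift_edge, twist_flow]

open Classical in
/-- The second homotopy: follow the lifted geodesics back to `T_1`. On an edge `[w, w aⱼ]` that
points away from `1`, the flow by `2 t` interpolates between the identity at `t = 0` and the map
`coglue ∘ glue`, which is what the path from `T_{w aⱼ}` requires, at `t = 1`. -/
def shrink (z : Telescope F n) (s : I) : Telescope F n :=
  lift (fun w x => path (word w) x ((1 - s) * (word w).length))
    (fun w j x t => if Away w j then
      pathExt (word w) j (x.flow (2 * t)) ((1 - s) * ((word w).length + t))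
      else path (word w) x ((1 - s) * ((word w).length - t)))
    (fun w j x => by
      have h0 : (1 - (s : ℝ)) * (word w).length ≤ (word w).length :=
        mul_le_of_le_one_left (by positivity) (by linarith [s.2.1])
      simp only [Set.Icc.coe_zero, mul_zero, Tree.flow_zero, add_zero, sub_zero,
        pathExt_of_le _ _ _ h0, ite_self])
    (fun w j x => by
      split_ifs with h
      · rw [h, path_false, Tree.coglue_glue]
        simp
      · have h0 : (1 - (s : ℝ)) * (word (w * FreeGroup.of j)).length ≤
            (word (w * FreeGroup.of j)).length :=
          mul_le_of_le_one_left (by positivity) (by linarith [s.2.1])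
        rw [word_of_not_away h, List.length_cons]
        simp only [Nat.cast_add, Nat.cast_one, Set.Icc.coe_one, add_sub_cancel_right]
        exact path_true_of_le _ _ _ h0) z

theorem continuous_shrink : Continuous fun p : Telescope F n × I => shrink p.1 p.2 := by
  refine continuous_prod_of_pieces (fun w => ?_) fun w j => ?_
  · simp only [shrink, lift_vert]
    fun_prop
  · simp only [shrink, lift_edge]
    split_ifs <;> fun_prop

theorem shrink_zero (z : Telescope F n) : shrink z 0 = raise z 1 := by
  induction z using cases_pieces with
  | hv w x =>
    simp [raise, shrink, lift_vert, path_length, wordVal_word]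
  | he w j x t =>
    have ht := t.2.1
    have ht1 := t.2.2
    simp only [raise, shrink, lift_edge, Set.Icc.coe_zero, sub_zero, one_mul, mul_one]
    split_ifs with h
    · rw [pathExt_of_ge _ _ _ (by linarith), add_sub_cancel_left, Set.projIcc_val,
        Tree.flow_add _ (by positivity) (by positivity), wordVal_word]
      ring_nf
    · have hw := word_of_not_away h
      have h1 := wordVal_word w
      rw [hw] at h1
      rw [← steps_word_mul_of_not_away h, hw, path_true_of_ge _ _ _ (by
        simp only [List.length_cons, Nat.cast_add, Nat.cast_one]; linarith), h1]
      have e : 1 - ((((j, true) :: word (w * FreeGroup.of j)).length : ℝ) - (t : ℝ) -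
          (word (w * FreeGroup.of j)).length) = t := by
        simp only [List.length_cons, Nat.cast_add, Nat.cast_one]
        ring
      rw [e, Set.projIcc_val, add_zero]

theorem shrink_inl_smul (f : Base F n) (z : Telescope F n) (s : I) :
    shrink ((SemidirectProduct.inl f : Wreath F n) • z) s =
      (SemidirectProduct.inl f : Wreath F n) • shrink z s := by
  induction z using cases_pieces with
  | hv w x =>
    simp only [inl_smul_vert, shrink, lift_vert, path_word_twist]
  | he w j x t =>
    simp only [inl_smul_edge, shrink, lift_edge]
    split_ifs
    · rw [← twist_flow, pathExt_word_twist]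
    · rw [path_word_twist]

open Classical in
/-- The `B`-equivariant map from the telescope to `T_1` at which the two homotopies end. -/
def retract : Telescope F n → Tree F n :=
  lift (fun w x => pathStart (word w) x)
    (fun w j x t => if Away w j then pathStart (word w) (x.flow (2 * t)) else pathStart (word w) x)
    (fun w j x => by simp [Tree.flow_zero])
    (fun w j x => by
      split_ifs with h
      · rw [h, pathStart, Tree.coglue_glue]
        simp
      · rw [word_of_not_away h, pathStart])

theorem continuous_retract : Continuous (retract (F := F) (n := n)) := by
  refine continuous_of_pieces (fun w => ?_) fun w j => ?_
  · simp only [retract, lift_vert]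
    fun_prop
  · simp only [retract, lift_edge]
    split_ifs <;> fun_prop

theorem shrink_one (z : Telescope F n) : shrink z 1 = vert 1 (retract z) := by
  induction z using cases_pieces with
  | hv w x =>
    simp [shrink, retract, lift_vert, path_zero]
  | he w j x t =>
    simp only [shrink, retract, lift_edge, Set.Icc.coe_one, sub_self, zero_mul]
    split_ifs
    · rw [pathExt_of_le _ _ _ (by positivity), path_zero]
    · rw [path_zero]

theorem retract_inl_smul (f : Base F n) (z : Telescope F n) :
    retract ((SemidirectProduct.inl f : Wreath F n) • z) = f • retract z := by
  induction z using cases_pieces with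
  | hv w x =>
    simp only [inl_smul_vert, retract, lift_vert, pathStart_word_twist]
  | he w j x t =>
    simp only [inl_smul_edge, retract, lift_edge, ← twist_flow, pathStart_word_twist]
    split_ifs <;> rfl

/-- If some vertex of `T_1` is fixed by `S ⊆ B`, then the set of fixed points of `S` in the
telescope is contractible: it deforms into the fixed points of `S` in `T_1`. -/
theorem contractible_fixed (S : Set (Base F n)) (v₀ : Vertex F n) (hS : ∀ f ∈ S, f • v₀ = v₀) :
    ContractibleSpace
      {z : Telescope F n | ∀ f ∈ S, (SemidirectProduct.inl f : Wreath F n) • z = z} := by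
  have hT := Tree.contractible_fixed S v₀ hS
  rw [contractible_iff_id_nullhomotopic]
  let ZS := {z : Telescope F n | ∀ f ∈ S, (SemidirectProduct.inl f : Wreath F n) • z = z}
  let TS := {x : Tree F n | ∀ f ∈ S, f • x = x}
  let r : C(ZS, TS) := ⟨fun z => ⟨retract z.1, fun f hf => by
    rw [← retract_inl_smul, z.2 f hf]⟩,
    (continuous_retract.comp continuous_subtype_val).subtype_mk _⟩
  let i : C(TS, ZS) := ⟨fun x => ⟨vert 1 x.1, fun f hf => by
    rw [inl_smul_vert, twist, inv_one, map_one, MulAut.one_apply, x.2 f hf]⟩,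
    ((continuous_vert 1).comp continuous_subtype_val).subtype_mk _⟩
  have m1 : ∀ z ∈ ZS, ∀ s : I, raise z s ∈ ZS := fun z hz s f hf => by
    rw [← raise_inl_smul, hz f hf]
  have m2 : ∀ z ∈ ZS, ∀ s : I, shrink z s ∈ ZS := fun z hz s f hf => by
    rw [← shrink_inl_smul, hz f hf]
  let g : C(ZS, ZS) := ⟨fun z => ⟨raise z.1 (1 : I), m1 z z.2 1⟩,
    (continuous_raise.comp (continuous_subtype_val.prodMk continuous_const)).subtype_mk _⟩
  have h1 : (ContinuousMap.id ZS).Homotopic g :=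
    homotopic_restrict _ continuous_raise m1 (fun z => (raise_zero z.1).symm) fun z => rfl
  have h2 : g.Homotopic (i.comp r) :=
    homotopic_restrict _ continuous_shrink m2 (fun z => (shrink_zero z.1).symm)
      fun z => (shrink_one z.1).symm
  obtain ⟨x, hx⟩ := id_nullhomotopic TS
  refine ⟨i x, (h1.trans h2).trans ?_⟩
  exact ((ContinuousMap.Homotopic.refl i).comp (hx.comp (ContinuousMap.Homotopic.refl r)) : _)

end Telescope

/-! ### Continuous real functions separate points -/

theorem Vertex.up_ne (v : Vertex F n) : v.up ≠ v := by
  intro h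
  have := congrArg (fun v : Vertex F n => (v.1 : ℕ)) h
  simp [Vertex.up] at this

namespace Tree

open Classical in
/-- The barycentric coordinate of the vertex `v`. -/
def tent (v : Vertex F n) : Tree F n → ℝ :=
  lift (fun e t => (1 - t) * (if e = v then 1 else 0) + t * (if e.up = v then 1 else 0))
    (fun e => by simp)

@[fun_prop]
theorem continuous_tent (v : Vertex F n) : Continuous (tent v) :=
  continuous_of_edge fun e => by simp only [tent, lift_edge]; fun_prop

theorem tent_up (e : Vertex F n) (t : I) : tent e.up (edge e t) = t := by
  simp [tent, lift_edge, e.up_ne.symm]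

open Classical in
theorem tent_vert (v e : Vertex F n) : tent v (vert e) = if e = v then 1 else 0 := by
  simp [tent, lift_vert]

open Classical in
/-- A function supported on the interior of the edge `e`. -/
def bump (e : Vertex F n) : Tree F n → ℝ :=
  lift (fun e' t => if e' = e then (t : ℝ) * (1 - t) else 0) (fun e => by simp)

theorem continuous_bump (e : Vertex F n) : Continuous (bump e) :=
  continuous_of_edge fun e => by simp only [bump, lift_edge]; split_ifs <;> fun_prop

theorem cases_interior {motive : Tree F n → Prop} (hv : ∀ v, motive (vert v))
    (he : ∀ e (t : I), 0 < t → t < 1 → motive (edge e t)) (x : Tree F n) : motive x := by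
  obtain ⟨e, t, rfl⟩ := exists_edge x
  rcases eq_or_ne t 0 with rfl | h0
  · rw [edge_zero]; exact hv e
  rcases eq_or_ne t 1 with rfl | h1
  · rw [edge_one]; exact hv e.up
  · exact he e t (unitInterval.pos_iff_ne_zero.2 h0) (unitInterval.lt_one_iff_ne_one.2 h1)

theorem bump_edge_pos (e : Vertex F n) {t : I} (h0 : 0 < t) (h1 : t < 1) :
    0 < bump e (edge e t) := by
  simp only [bump, lift_edge, if_true]
  exact mul_pos h0 (sub_pos.2 h1)

theorem exists_of_bump_ne_zero {e : Vertex F n} {x : Tree F n} (h : bump e x ≠ 0) :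
    ∃ t, x = edge e t := by
  obtain ⟨e', t, rfl⟩ := exists_edge x
  simp only [bump, lift_edge] at h
  split_ifs at h with h'
  · exact ⟨t, by rw [h']⟩
  · exact absurd rfl h

theorem eq_of_forall_continuous {x y : Tree F n}
    (h : ∀ g : Tree F n → ℝ, Continuous g → g x = g y) : x = y := by
  have key : ∀ (e : Vertex F n) (t : I) (y : Tree F n), 0 < t → t < 1 →
      (∀ g : Tree F n → ℝ, Continuous g → g (edge e t) = g y) → edge e t = y := by
    intro e t y h0 h1 h
    -- The bump function finds the edge, the barycentric coordinate the position on it.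
    have h2 := bump_edge_pos e h0 h1
    rw [h _ (continuous_bump e)] at h2
    obtain ⟨t', rfl⟩ := exists_of_bump_ne_zero h2.ne'
    have h3 := h _ (continuous_tent e.up)
    rw [tent_up, tent_up] at h3
    rw [Subtype.ext h3]
  induction x using cases_interior with
  | he e t h0 h1 => exact key e t y h0 h1 h
  | hv v =>
    induction y using cases_interior with
    | he e t h0 h1 => exact (key e t _ h0 h1 fun g hg => (h g hg).symm).symm
    | hv v' =>
      have h3 := h _ (continuous_tent v)
      rw [tent_vert, tent_vert, if_pos rfl] at h3
      by_cases h4 : v' = v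
      · rw [h4]
      · rw [if_neg h4] at h3
        exact absurd h3 one_ne_zero

end Tree

namespace Telescope

theorem mul_of_ne (w : FreeGroup (Fin n)) (j : Fin n) : w * FreeGroup.of j ≠ w := by
  rw [Ne, mul_eq_left]
  exact FreeGroup.of_ne_one j

/-- The function on the telescope that is given by `φ w` on `T_w` and is interpolated linearly
along the edges of the Cayley graph. -/
def interp (φ : FreeGroup (Fin n) → Tree F n → ℝ) : Telescope F n → ℝ :=
  lift φ (fun w j x t => (1 - t) * φ w x + t * φ (w * FreeGroup.of j) (x.glue j))
    (fun w j x => by simp) (fun w j x => by simp)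

theorem continuous_interp {φ : FreeGroup (Fin n) → Tree F n → ℝ} (h : ∀ w, Continuous (φ w)) :
    Continuous (interp φ) :=
  continuous_of_pieces h fun w j => by
    simp only [interp, lift_edge]
    have := h w
    have := h (w * FreeGroup.of j)
    have := Tree.continuous_glue (F := F) j
    fun_prop

open Classical in
/-- The barycentric coordinate of the vertex `w` of the Cayley graph. -/
def baseTent (w : FreeGroup (Fin n)) : Telescope F n → ℝ :=
  interp fun w' _ => if w' = w then 1 else 0

theorem continuous_baseTent (w : FreeGroup (Fin n)) : Continuous (baseTent (F := F) w) :=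
  continuous_interp fun _ => continuous_const

theorem baseTent_mul_of (w : FreeGroup (Fin n)) (j : Fin n) (x : Tree F n) (t : I) :
    baseTent (w * FreeGroup.of j) (edge w j x t) = t := by
  simp [baseTent, interp, lift_edge]

open Classical in
/-- The function `g` on `T_w`, multiplied with a function supported on the interior of the edge
`[w, w aⱼ]`. -/
def bump (w : FreeGroup (Fin n)) (j : Fin n) (g : Tree F n → ℝ) : Telescope F n → ℝ :=
  lift (fun _ _ => 0) (fun w' j' x t => if w' = w ∧ j' = j then (t : ℝ) * (1 - t) * g x else 0)
    (fun w j x => by simp) (fun w j x => by simp)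

theorem continuous_bump (w : FreeGroup (Fin n)) (j : Fin n) {g : Tree F n → ℝ}
    (hg : Continuous g) : Continuous (bump w j g) :=
  continuous_of_pieces (fun _ => continuous_const) fun w j => by
    simp only [bump, lift_edge]; split_ifs <;> fun_prop

theorem bump_edge (w : FreeGroup (Fin n)) (j : Fin n) (g : Tree F n → ℝ) (x : Tree F n) (t : I) :
    bump w j g (edge w j x t) = t * (1 - t) * g x := by
  simp [bump, lift_edge]

theorem exists_of_bump_ne_zero {w : FreeGroup (Fin n)} {j : Fin n} {g : Tree F n → ℝ}
    {z : Telescope F n} (h : bump w j g z ≠ 0) : ∃ x t, z = edge w j x t := by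
  induction z using cases_pieces with
  | hv w' x => exact absurd rfl h
  | he w' j' x t =>
    simp only [bump, lift_edge] at h
    split_ifs at h with h'
    · exact ⟨x, t, by rw [h'.1, h'.2]⟩
    · exact absurd rfl h

@[elab_as_elim]
theorem cases_interior {motive : Telescope F n → Prop} (hv : ∀ w x, motive (vert w x))
    (he : ∀ w j x (t : I), 0 < t → t < 1 → motive (edge w j x t)) (z : Telescope F n) :
    motive z := by
  induction z using cases_pieces with
  | hv w x => exact hv w x
  | he w j x t =>
    rcases eq_or_ne t 0 with rfl | h0
    · rw [edge_zero]; exact hv _ _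
    rcases eq_or_ne t 1 with rfl | h1
    · rw [edge_one]; exact hv _ _
    · exact he w j x t (unitInterval.pos_iff_ne_zero.2 h0) (unitInterval.lt_one_iff_ne_one.2 h1)

theorem eq_of_forall_continuous {z z' : Telescope F n}
    (h : ∀ g : Telescope F n → ℝ, Continuous g → g z = g z') : z = z' := by
  have key : ∀ w j x (t : I) (z : Telescope F n), 0 < t → t < 1 →
      (∀ g : Telescope F n → ℝ, Continuous g → g (edge w j x t) = g z) →
      edge w j x t = z := by
    intro w j x t z h0 h1 h
    have hpos : (0 : ℝ) < t * (1 - t) := mul_pos h0 (sub_pos.2 h1)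
    have h2 := h _ (continuous_bump w j (continuous_const (y := (1 : ℝ))))
    rw [bump_edge, mul_one] at h2
    obtain ⟨x', t', rfl⟩ := exists_of_bump_ne_zero (h2 ▸ hpos.ne')
    have h3 := h _ (continuous_baseTent (w * FreeGroup.of j))
    rw [baseTent_mul_of, baseTent_mul_of] at h3
    obtain rfl : t = t' := Subtype.ext h3
    have h4 : x = x' := Tree.eq_of_forall_continuous fun g hg => by
      have h5 := h _ (continuous_bump w j hg)
      rw [bump_edge, bump_edge] at h5
      exact mul_left_cancel₀ hpos.ne' h5
    rw [h4]
  induction z using cases_interior with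
  | he w j x t h0 h1 => exact key w j x t z' h0 h1 h
  | hv w x =>
    induction z' using cases_interior with
    | he w j x t h0 h1 => exact (key w j x t _ h0 h1 fun g hg => (h g hg).symm).symm
    | hv w' x' =>
      have h3 := h _ (continuous_baseTent w)
      simp only [baseTent, interp, lift_vert, if_true] at h3
      by_cases h4 : w' = w
      · subst h4
        have h5 : x = x' := Tree.eq_of_forall_continuous fun g hg =>
          h (interp fun _ => g) (continuous_interp fun _ => hg)
        rw [h5]
      · rw [if_neg h4] at h3
        exact absurd h3 one_ne_zero

instance : T2Space (Telescope F n) where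
  t2 z z' hne := by
    by_contra hc
    refine hne (eq_of_forall_continuous fun g hg => ?_)
    by_contra hg'
    exact hc (separated_by_continuous hg hg')

instance : ContinuousConstSMul (Wreath F n) (Telescope F n) where
  continuous_const_smul γ := by
    refine continuous_of_pieces (fun w => ?_) fun w j => ?_
    · exact (continuous_vert _).comp (Tree.continuous_smul _)
    · have h : Continuous fun x : Tree F n => twist (γ.right * w) γ.left x :=
        Tree.continuous_smul _
      simp only [smul_edge]
      fun_prop

end Telescope

/-! ### The cells -/

/-- The point with parameter `s` in the closed cell of `T` that is the vertex `v` (for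
`b = false`) or the edge labelled `v` (for `b = true`). -/
def Tree.point (v : Vertex F n) (b : Bool) (s : I) : Tree F n :=
  if b then Tree.edge v s else Tree.vert v

open Classical in
/-- The open cell of `T` that contains a given point. -/
def Tree.cellOf : Tree F n → Vertex F n × Bool :=
  Tree.lift (fun e t => if t = 0 then (e, false) else if t = 1 then (e.up, false) else (e, true))
    (fun e => by simp)

theorem Tree.cellOf_point (v : Vertex F n) (b : Bool) {s : I} (h0 : 0 < s) (h1 : s < 1) :
    Tree.cellOf (Tree.point v b s) = (v, b) := by
  cases b
  · simp [Tree.point, Tree.cellOf, Tree.lift_vert]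
  · simp [Tree.point, Tree.cellOf, Tree.lift_edge, h0.ne', h1.ne]

variable (F n) in
/-- The cells of the telescope: a cell of the Cayley graph (the vertex `base`, or for
`dir = some j` the edge from `base` in the direction `j`) times a cell of the tree (the vertex
`label` or, for `isEdge = true`, the edge `label`). -/
structure Cell : Type u where
  /-- The starting point in the Cayley graph. -/
  base : FreeGroup (Fin n)
  /-- The direction of the edge in the Cayley graph, if there is one. -/
  dir : Option (Fin n)
  /-- The label of the cell of the tree. -/
  label : Vertex F n
  /-- Whether the cell of the tree is an edge. -/
  isEdge : Bool

namespace Cell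

/-- The dimension of a cell. -/
def dim (c : Cell F n) : ℕ := c.dir.toList.length + c.isEdge.toNat

/-- The point of a closed cell with parameter `s` along the edge of the tree and parameter `t` along
the edge of the Cayley graph; parameters that do not make sense are ignored. -/
def point (c : Cell F n) (s t : I) : Telescope F n :=
  match c.dir with
  | none => Telescope.vert c.base (Tree.point c.label c.isEdge s)
  | some j => Telescope.edge c.base j (Tree.point c.label c.isEdge s) t

@[fun_prop]
theorem _root_.Continuous.treePoint {A : Type*} [TopologicalSpace A] {f : A → I}
    (hf : Continuous f) (v : Vertex F n) (b : Bool) : Continuous fun a => Tree.point v b (f a) := by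
  cases b
  · exact continuous_const
  · exact (Tree.continuous_edge v).comp hf

@[fun_prop]
theorem _root_.Continuous.cellPoint {A : Type*} [TopologicalSpace A] {f g : A → I}
    (hf : Continuous f) (hg : Continuous g) (c : Cell F n) :
    Continuous fun a => c.point (f a) (g a) := by
  obtain ⟨w, - | j, v, b⟩ := c
  · show Continuous fun a => Telescope.vert w (Tree.point v b (f a))
    exact (Telescope.continuous_vert w).comp (hf.treePoint v b)
  · exact (hf.treePoint v b).telescopeEdge hg w j

theorem exists_point (z : Telescope F n) :
    ∃ (c : Cell F n) (s t : I), 0 < s ∧ s < 1 ∧ 0 < t ∧ t < 1 ∧ z = c.point s t := by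
  have hT : ∀ x : Tree F n, ∃ v b, ∃ s : I, 0 < s ∧ s < 1 ∧ x = Tree.point v b s := by
    intro x
    have h : ∃ s : I, 0 < s ∧ s < 1 := exists_between zero_lt_one
    induction x using Tree.cases_interior with
    | hv v =>
      obtain ⟨s, h0, h1⟩ := h
      exact ⟨v, false, s, h0, h1, rfl⟩
    | he e t h0 h1 => exact ⟨e, true, t, h0, h1, rfl⟩
  induction z using Telescope.cases_interior with
  | hv w x =>
    obtain ⟨v, b, s, h0, h1, rfl⟩ := hT x
    exact ⟨⟨w, none, v, b⟩, s, s, h0, h1, h0, h1, rfl⟩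
  | he w j x t h0' h1' =>
    obtain ⟨v, b, s, h0, h1, rfl⟩ := hT x
    exact ⟨⟨w, some j, v, b⟩, s, t, h0, h1, h0', h1', rfl⟩

open Classical in
/-- The open cell that contains a given point. -/
def ofPoint : Telescope F n → Cell F n :=
  Telescope.lift (fun w x => ⟨w, none, x.cellOf.1, x.cellOf.2⟩)
    (fun w j x t => if t = 0 then ⟨w, none, x.cellOf.1, x.cellOf.2⟩ else
      if t = 1 then ⟨w * FreeGroup.of j, none, (x.glue j).cellOf.1, (x.glue j).cellOf.2⟩ else
      ⟨w, some j, x.cellOf.1, x.cellOf.2⟩)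
    (fun w j x => by simp) (fun w j x => by simp)

theorem ofPoint_point (c : Cell F n) {s t : I} (h0 : 0 < s) (h1 : s < 1) (h0' : 0 < t)
    (h1' : t < 1) : ofPoint (c.point s t) = c := by
  obtain ⟨w, - | j, v, b⟩ := c
  · simp [ofPoint, point, Telescope.lift_vert, Tree.cellOf_point v b h0 h1]
  · simp [ofPoint, point, Telescope.lift_edge, Tree.cellOf_point v b h0 h1, h0'.ne', h1'.ne]

/-- The action of `Γ` on the set of cells. -/
def act (γ : Wreath F n) (c : Cell F n) : Cell F n :=
  ⟨γ.right * c.base, c.dir, shift F n (γ.right * c.base)⁻¹ γ.left • c.label, c.isEdge⟩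

theorem smul_point (γ : Wreath F n) (c : Cell F n) (s t : I) :
    γ • c.point s t = (c.act γ).point s t := by
  obtain ⟨w, - | j, v, - | b⟩ := c <;> rfl

/-- The cells that can occur as proper faces of a cell. -/
def faces (c : Cell F n) : Set (Cell F n) :=
  {{c with isEdge := false}, {c with label := c.label.up, isEdge := false}, {c with dir := none}} ∪
    Set.range fun j => ⟨c.base * FreeGroup.of j, none, c.label.glue j, c.isEdge⟩

theorem finite_faces (c : Cell F n) : c.faces.Finite :=
  (Set.toFinite _).union (Set.finite_range _)

theorem exists_face_of_isEdge (c : Cell F n) (hc : c.isEdge = true) {s : I} (hs : s = 0 ∨ s = 1)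
    (t : I) : ∃ c' ∈ c.faces, c'.dim < c.dim ∧ c.point s t = c'.point s t := by
  obtain ⟨w, d, v, b⟩ := c
  obtain rfl : b = true := hc
  rcases hs with rfl | rfl
  · refine ⟨⟨w, d, v, false⟩, by simp [faces], by simp [dim], ?_⟩
    simp [point, Tree.point, Tree.edge_zero]
  · refine ⟨⟨w, d, v.up, false⟩, by simp [faces], by simp [dim], ?_⟩
    simp [point, Tree.point, Tree.edge_one]

theorem exists_face_of_dir (c : Cell F n) (hc : c.dir ≠ none) (s : I) {t : I}
    (ht : t = 0 ∨ t = 1) : ∃ c' ∈ c.faces, c'.dim < c.dim ∧ c.point s t = c'.point s t := by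
  obtain ⟨w, - | j, v, b⟩ := c
  · exact absurd rfl hc
  rcases ht with rfl | rfl
  · exact ⟨⟨w, none, v, b⟩, by simp [faces], by simp [dim], Telescope.edge_zero _ _ _⟩
  · refine ⟨⟨w * FreeGroup.of j, none, v.glue j, b⟩, Or.inr ⟨j, rfl⟩, by simp [dim],
      (Telescope.edge_one _ _ _).trans ?_⟩
    cases b <;> rfl

/-! ### The characteristic maps -/

/-- The affine map from `[-1, 1]` to `[0, 1]`, extended by constants. -/
def param (r : ℝ) : I := Set.projIcc 0 1 zero_le_one ((1 + r) / 2)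

@[fun_prop]
theorem continuous_param : Continuous param := continuous_projIcc.comp (by fun_prop)

theorem coe_param {r : ℝ} (h0 : -1 ≤ r) (h1 : r ≤ 1) : (param r : ℝ) = (1 + r) / 2 := by
  rw [param, Set.projIcc_of_mem _ ⟨by linarith, by linarith⟩]

theorem param_two_mul_sub_one (t : I) : param (2 * t - 1) = t := by
  have h0 := t.2.1
  have h1 := t.2.2
  exact Subtype.ext ((coe_param (by linarith) (by linarith)).trans (by ring))

theorem param_eq_zero_or_one {r : ℝ} (h : |r| = 1) : param r = 0 ∨ param r = 1 := by
  rcases eq_or_eq_neg_of_abs_eq h with rfl | rfl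
  · exact Or.inr (by simp [param])
  · exact Or.inl (by simp [param])

theorem param_mem_Ioo {r : ℝ} (h : |r| < 1) : 0 < param r ∧ param r < 1 := by
  obtain ⟨h0, h1⟩ := abs_lt.1 h
  have e := coe_param h0.le h1.le
  constructor
  · show (0 : ℝ) < param r
    linarith
  · show (param r : ℝ) < 1
    linarith

/-- The first coordinate of a vector, or `0` in dimension `0`. -/
def first {m : ℕ} (x : Fin m → ℝ) : ℝ := if h : 0 < m then x ⟨0, h⟩ else 0

/-- The last coordinate of a vector, or `0` in dimension `0`. -/
def last {m : ℕ} (x : Fin m → ℝ) : ℝ :=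
  if h : 0 < m then x ⟨m - 1, Nat.sub_lt h one_pos⟩ else 0

@[fun_prop]
theorem continuous_first {m : ℕ} : Continuous (first (m := m)) := by
  unfold first; split_ifs <;> fun_prop

@[fun_prop]
theorem continuous_last {m : ℕ} : Continuous (last (m := m)) := by
  unfold last; split_ifs <;> fun_prop

/-- The characteristic map. In dimension `2` the first coordinate runs along the edge of the tree
and the last one along the edge of the Cayley graph; in dimension `1` only one of the two parameters
matters, and both are set to the only coordinate. -/
def charMap {m : ℕ} (c : Cell F n) (x : Fin m → ℝ) : Telescope F n :=
  c.point (param (first x)) (param (last x))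

@[fun_prop]
theorem continuous_charMap {m : ℕ} (c : Cell F n) : Continuous (c.charMap (m := m)) := by
  unfold charMap; fun_prop

theorem abs_first_le {m : ℕ} (x : Fin m → ℝ) : |first x| ≤ ‖x‖ := by
  unfold first
  split_ifs
  · exact norm_le_pi_norm x _
  · simp

theorem abs_last_le {m : ℕ} (x : Fin m → ℝ) : |last x| ≤ ‖x‖ := by
  unfold last
  split_ifs
  · exact norm_le_pi_norm x _
  · simp

theorem ofPoint_charMap {m : ℕ} (c : Cell F n) {x : Fin m → ℝ} (hx : ‖x‖ < 1) :
    ofPoint (c.charMap x) = c :=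
  have h1 := param_mem_Ioo ((abs_first_le x).trans_lt hx)
  have h2 := param_mem_Ioo ((abs_last_le x).trans_lt hx)
  ofPoint_point c h1.1 h1.2 h2.1 h2.2

/-- The vector of coordinates with parameters `s` and `t`. -/
def coords (c : Cell F n) (m : ℕ) (s t : ℝ) : Fin m → ℝ :=
  fun i => if i.1 = 0 ∧ c.isEdge = true then 2 * s - 1 else 2 * t - 1

theorem charMap_coords (c : Cell F n) {m : ℕ} (hm : c.dim = m) (s t : I) :
    c.charMap (c.coords m s t) = c.point s t := by
  obtain ⟨w, - | j, v, - | b⟩ := c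
  · rfl
  · obtain rfl : m = 1 := hm.symm
    simp [charMap, coords, first, point, param_two_mul_sub_one]
  · obtain rfl : m = 1 := hm.symm
    simp [charMap, coords, last, point, param_two_mul_sub_one, Tree.point]
  · obtain rfl : m = 2 := hm.symm
    simp [charMap, coords, first, last, point, param_two_mul_sub_one]

theorem coords_mem (c : Cell F n) (m : ℕ) (s t : I) :
    c.coords m s t ∈ Metric.closedBall (0 : Fin m → ℝ) 1 := by
  rw [mem_closedBall_zero_iff, pi_norm_le_iff_of_nonneg zero_le_one]
  intro i
  have hs := s.2
  have ht := t.2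
  rw [coords, Real.norm_eq_abs, abs_le]
  split_ifs
  · exact ⟨by linarith [hs.1], by linarith [hs.2]⟩
  · exact ⟨by linarith [ht.1], by linarith [ht.2]⟩

theorem point_mem (c : Cell F n) {m : ℕ} (hm : c.dim = m) (s t : I) :
    c.point s t ∈ c.charMap '' Metric.closedBall (0 : Fin m → ℝ) 1 :=
  ⟨_, c.coords_mem m s t, c.charMap_coords hm s t⟩

theorem exists_face {m : ℕ} (c : Cell F n) (hm : c.dim = m) {x : Fin m → ℝ} (hx : ‖x‖ = 1) :
    ∃ c' ∈ c.faces, c'.dim < m ∧ ∃ s t, c.charMap x = c'.point s t := by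
  have hne : Nonempty (Fin m) := by
    by_contra h
    rw [not_nonempty_iff] at h
    rw [Subsingleton.elim x 0, norm_zero] at hx
    exact zero_ne_one hx
  obtain ⟨i, hi⟩ : ∃ i, |x i| = 1 := by
    obtain ⟨i, hi⟩ := Finite.exists_max fun i => ‖x i‖
    refine ⟨i, ((norm_le_pi_norm x i).trans hx.le).antisymm ?_⟩
    rw [← hx]
    exact (pi_norm_le_iff_of_nonneg (norm_nonneg _)).2 hi
  have key : (c.isEdge = true ∧ |first x| = 1) ∨ (c.dir ≠ none ∧ |last x| = 1) := by
    obtain ⟨w, - | j, v, - | b⟩ := c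
    · obtain rfl : m = 0 := hm.symm
      exact i.elim0
    · obtain rfl : m = 1 := hm.symm
      obtain rfl := Subsingleton.elim i 0
      exact Or.inl ⟨rfl, by simpa [first] using hi⟩
    · obtain rfl : m = 1 := hm.symm
      obtain rfl := Subsingleton.elim i 0
      exact Or.inr ⟨by simp, by simpa [last] using hi⟩
    · obtain rfl : m = 2 := hm.symm
      fin_cases i
      · exact Or.inl ⟨rfl, by simpa [first] using hi⟩
      · exact Or.inr ⟨by simp, by simpa [last] using hi⟩
  rcases key with ⟨h1, h2⟩ | ⟨h1, h2⟩
  · obtain ⟨c', hc, hd, he⟩ :=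
      c.exists_face_of_isEdge h1 (param_eq_zero_or_one h2) (param (last x))
    exact ⟨c', hc, hd.trans_eq hm, _, _, he⟩
  · obtain ⟨c', hc, hd, he⟩ :=
      c.exists_face_of_dir h1 (param (first x)) (param_eq_zero_or_one h2)
    exact ⟨c', hc, hd.trans_eq hm, _, _, he⟩

open Classical in
/-- A continuous function on the telescope that is equal to the parameter along the edge of the
tree on the closed cell `c`. -/
def treeParam (c : Cell F n) : Telescope F n → ℝ :=
  Telescope.interp fun w x =>
    if w = c.base then x.tent c.label.up else
      match c.dir with
      | none => 0
      | some j => x.tent (c.label.glue j).up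

theorem continuous_treeParam (c : Cell F n) : Continuous c.treeParam :=
  Telescope.continuous_interp fun w => by
    split_ifs
    · fun_prop
    · cases c.dir
      · exact continuous_const
      · exact Tree.continuous_tent _

theorem treeParam_point (c : Cell F n) (hc : c.isEdge = true) (s t : I) :
    c.treeParam (c.point s t) = s := by
  obtain ⟨w, - | j, v, b⟩ := c <;> obtain rfl : b = true := hc
  · simp [treeParam, point, Telescope.interp, Telescope.lift_vert, Tree.point, Tree.tent_up]
  · have h : (Tree.edge v s).glue j = Tree.edge (v.glue j) s := rfl
    simp only [treeParam, point, Telescope.interp, Telescope.lift_edge, Tree.point, if_true,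
      Tree.tent_up, h, if_neg (Telescope.mul_of_ne w j)]
    ring

/-- A continuous function on the telescope that is equal to the parameter along the edge of the
Cayley graph on the closed cell `c`. -/
def baseParam (c : Cell F n) : Telescope F n → ℝ :=
  match c.dir with
  | none => 0
  | some j => Telescope.baseTent (c.base * FreeGroup.of j)

theorem continuous_baseParam (c : Cell F n) : Continuous c.baseParam := by
  unfold baseParam
  cases c.dir
  · exact continuous_const
  · exact Telescope.continuous_baseTent _

theorem baseParam_point (c : Cell F n) (hc : c.dir ≠ none) (s t : I) :
    c.baseParam (c.point s t) = t := by
  obtain ⟨w, - | j, v, b⟩ := c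
  · exact absurd rfl hc
  · exact Telescope.baseTent_mul_of _ _ _ _

/-- A continuous left inverse of the characteristic map on the closed ball, defined on the whole
telescope. -/
def charInv (c : Cell F n) (m : ℕ) (z : Telescope F n) : Fin m → ℝ :=
  c.coords m (c.treeParam z) (c.baseParam z)

theorem continuous_charInv (c : Cell F n) (m : ℕ) : Continuous (c.charInv m) := by
  have h1 := c.continuous_treeParam
  have h2 := c.continuous_baseParam
  refine continuous_pi fun i => ?_
  unfold charInv coords
  split_ifs <;> fun_prop

theorem charInv_charMap (c : Cell F n) {m : ℕ} (hm : c.dim = m) {x : Fin m → ℝ}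
    (hx : ‖x‖ ≤ 1) : c.charInv m (c.charMap x) = x := by
  have hf := abs_le.1 ((abs_first_le x).trans hx)
  have hl := abs_le.1 ((abs_last_le x).trans hx)
  have e1 : c.isEdge = true → 2 * c.treeParam (c.charMap x) - 1 = first x := fun h => by
    rw [charMap, treeParam_point c h, coe_param hf.1 hf.2]; ring
  have e2 : c.dir ≠ none → 2 * c.baseParam (c.charMap x) - 1 = last x := fun h => by
    rw [charMap, baseParam_point c h, coe_param hl.1 hl.2]; ring
  funext i
  rw [charInv, coords]
  obtain ⟨w, - | j, v, - | b⟩ := c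
  · obtain rfl : m = 0 := hm.symm
    exact i.elim0
  · obtain rfl : m = 1 := hm.symm
    obtain rfl := Subsingleton.elim i 0
    rw [if_pos ⟨rfl, rfl⟩, e1 rfl]
    simp [first]
  · obtain rfl : m = 1 := hm.symm
    obtain rfl := Subsingleton.elim i 0
    rw [if_neg (by simp), e2 (by simp)]
    simp [last]
  · obtain rfl : m = 2 := hm.symm
    fin_cases i
    · rw [if_pos ⟨rfl, rfl⟩, e1 rfl]
      simp [first]
    · rw [if_neg (by simp), e2 (by simp)]
      simp [last]

end Cell

variable (F n) in
/-- The CW-structure on the telescope. -/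
@[reducible]
def cwComplex : Topology.CWComplex (Set.univ : Set (Telescope F n)) where
  cell m := {c : Cell F n // c.dim = m}
  map m c :=
    { toFun := c.1.charMap
      invFun := c.1.charInv m
      source := Metric.ball 0 1
      target := c.1.charMap '' Metric.ball 0 1
      map_source' := fun x hx => Set.mem_image_of_mem _ hx
      map_target' := by
        rintro _ ⟨x, hx, rfl⟩
        rw [c.1.charInv_charMap c.2 (mem_ball_zero_iff.1 hx).le]
        exact hx
      left_inv' := fun x hx => c.1.charInv_charMap c.2 (mem_ball_zero_iff.1 hx).le
      right_inv' := by
        rintro _ ⟨x, hx, rfl⟩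
        rw [c.1.charInv_charMap c.2 (mem_ball_zero_iff.1 hx).le] }
  source_eq _ _ := rfl
  continuousOn _ c := c.1.continuous_charMap.continuousOn
  continuousOn_symm m c := (c.1.continuous_charInv m).continuousOn
  pairwiseDisjoint' := by
    rintro ⟨m, c, rfl⟩ - ⟨m', c', rfl⟩ - hne
    refine Set.disjoint_left.2 ?_
    rintro _ ⟨x, hx, rfl⟩ ⟨x', hx', h⟩
    refine hne ?_
    have h1 := Cell.ofPoint_charMap c (mem_ball_zero_iff.1 hx)
    have h2 := Cell.ofPoint_charMap c' (mem_ball_zero_iff.1 hx')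
    obtain rfl : c = c' := by
      rw [← h1, ← h2]
      exact congrArg Cell.ofPoint h.symm
    rfl
  mapsTo' m c := by
    have hfin : ∀ k, {c' : {c : Cell F n // c.dim = k} | c'.1 ∈ c.1.faces}.Finite := fun k =>
      c.1.finite_faces.preimage Subtype.val_injective.injOn
    refine ⟨fun k => (hfin k).toFinset, fun x hx => ?_⟩
    obtain ⟨c', hc, hd, s, t, h⟩ := c.1.exists_face c.2 (mem_sphere_zero_iff_norm.1 hx)
    simp only [Set.mem_iUnion, Set.Finite.mem_toFinset, Set.mem_ofPred_eq]
    refine ⟨c'.dim, hd, ⟨c', rfl⟩, hc, ?_⟩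
    obtain ⟨y, hy, hy'⟩ := c'.point_mem rfl s t
    exact ⟨y, hy, hy'.trans h.symm⟩
  closed' A _ hA := by
    -- A set is closed if and only if the predicate defining its complement is continuous as a map
    -- to the Sierpiński space `Prop`, so that the criteria for continuity apply.
    have key : ∀ c : Cell F n, Continuous fun p : I × I => c.point p.1 p.2 ∉ A := by
      intro c
      rw [continuous_Prop]
      have h1 : IsClosed {p : I × I | c.point p.1 p.2 ∈
          A ∩ c.charMap '' Metric.closedBall (0 : Fin c.dim → ℝ) 1} :=
        (hA c.dim ⟨c, rfl⟩).preimage (by fun_prop)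
      convert h1.isOpen_compl using 1
      ext p
      exact not_congr (and_iff_left (c.point_mem rfl p.1 p.2)).symm
    have h : Continuous fun z : Telescope F n => z ∉ A := by
      refine Telescope.continuous_of_pieces (fun w => ?_) fun w j => ?_
      · refine Tree.continuous_of_edge fun e => ?_
        exact (key ⟨w, none, e, true⟩).comp (continuous_id.prodMk continuous_id)
      · exact Tree.continuous_prod_of_edge fun e => key ⟨w, some j, e, true⟩
    exact isOpen_compl_iff.1 (continuous_Prop.1 h)
  union' := by
    refine Set.eq_univ_of_forall fun z => ?_
    obtain ⟨c, s, t, -, -, -, -, rfl⟩ := Cell.exists_point z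
    simp only [Set.mem_iUnion]
    exact ⟨c.dim, ⟨c, rfl⟩, c.point_mem rfl s t⟩

theorem isGCW_cwComplex : IsGCW (Wreath F n) (cwComplex F n) := fun _ c γ =>
  ⟨⟨c.1.act γ, c.2⟩, fun _ _ => (Cell.smul_point γ c.1 _ _).symm⟩

theorem hasDim_cwComplex (hn : 1 ≤ n) : HasDim (cwComplex F n) 2 := by
  refine ⟨⟨⟨⟨1, some ⟨0, hn⟩, Vertex.coset 1 1, true⟩, rfl⟩⟩, fun m hm => ⟨?_⟩⟩
  rintro ⟨⟨w, - | j, v, - | b⟩, h⟩ <;> simp [Cell.dim] at h <;> omega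

/-! ### Stabilizers and finite subgroups -/

theorem finite_norm_le (n k : ℕ) : {w : FreeGroup (Fin n) | w.norm ≤ k}.Finite :=
  (List.finite_length_le (Fin n × Bool) k).preimage FreeGroup.toWord_injective.injOn

instance [Finite F] (k : ℕ) : Finite (ballSubgroup F n k) := by
  have := (finite_norm_le n k).to_subtype
  refine Finite.of_injective
    (fun (f : ballSubgroup F n k) (w : {w : FreeGroup (Fin n) | w.norm ≤ k}) => f.1.1 w.1) ?_
  intro f g h
  refine Subtype.ext (Subtype.ext (funext fun w => ?_))
  by_cases hw : w.norm ≤ k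
  · exact congrFun h ⟨w, hw⟩
  · rw [not_imp_comm.1 (f.2 w) hw, not_imp_comm.1 (g.2 w) hw]

/-- The stabilizer of `b Bₖ` is the conjugate of `Bₖ` by `b`. -/
theorem Vertex.finite_stabilizer [Finite F] (v : Vertex F n) :
    {f : Base F n | f • v = v}.Finite := by
  obtain ⟨b, h⟩ := v.exists_coset
  have hfin : {g : Base F n | g ∈ ballSubgroup F n v.1}.Finite :=
    Set.finite_coe_iff.1 (inferInstanceAs (Finite (ballSubgroup F n v.1)))
  refine (hfin.image fun g => b * g * b⁻¹).subset fun f hf => ⟨b⁻¹ * f * b, ?_, by group⟩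
  rw [Set.mem_ofPred_eq, h, Vertex.smul_coset] at hf
  have := Vertex.coset_eq_coset.1 hf.symm
  rwa [← mul_assoc] at this

theorem Cell.finite_stabilizer [Finite F] (c : Cell F n) :
    {γ : Wreath F n | c.act γ = c}.Finite := by
  have h1 : ∀ γ ∈ {γ : Wreath F n | c.act γ = c}, γ.right = 1 := fun γ hγ =>
    mul_eq_right.1 (congrArg Cell.base hγ)
  refine Set.Finite.of_injOn (f := fun γ => shift F n c.base⁻¹ γ.left) (fun γ hγ => ?_) ?_
    c.label.finite_stabilizer
  · have h2 := congrArg Cell.label hγ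
    simp only [Cell.act, h1 γ hγ, one_mul] at h2
    exact h2
  · intro γ hγ δ hδ h
    exact SemidirectProduct.ext ((shift F n c.base⁻¹).injective h)
      ((h1 γ hγ).trans (h1 δ hδ).symm)

theorem Telescope.finite_stabilizer [Finite F] (z : Telescope F n) :
    {γ : Wreath F n | γ • z = z}.Finite := by
  obtain ⟨c, s, t, h0, h1, h0', h1', rfl⟩ := Cell.exists_point z
  refine c.finite_stabilizer.subset fun γ hγ => ?_
  rw [Set.mem_ofPred_eq, Cell.smul_point] at hγ
  have := congrArg Cell.ofPoint hγ
  rwa [Cell.ofPoint_point _ h0 h1 h0' h1', Cell.ofPoint_point _ h0 h1 h0' h1'] at this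

/-- Free groups are torsion-free, so that finite subgroups of `Γ` lie in `B`. -/
theorem right_eq_one_of_finite (H : Subgroup (Wreath F n)) [Finite H] {γ : Wreath F n}
    (hγ : γ ∈ H) : γ.right = 1 := by
  have h1 : IsOfFinOrder (⟨γ, hγ⟩ : H) := isOfFinOrder_of_finite _
  have h2 := MonoidHom.isOfFinOrder (SemidirectProduct.rightHom.comp H.subtype) h1
  exact (isOfFinOrder_iff_eq_one _).1 h2

theorem contractible_fixedPoints_of_finite (H : Subgroup (Wreath F n)) [Finite H] :
    ContractibleSpace (MulAction.fixedPoints H (Telescope F n)) := by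
  let S : Set (Base F n) := {f | (SemidirectProduct.inl f : Wreath F n) ∈ H}
  have hS : S.Finite := (Set.toFinite (H : Set (Wreath F n))).preimage
    SemidirectProduct.inl_injective.injOn
  choose k hk using fun f : Base F n => exists_mem_ballSubgroup f
  obtain ⟨K, hK⟩ := (hS.image k).bddAbove
  have hfix : ∀ f ∈ S, f • Vertex.coset (F := F) (n := n) K.succPNat 1 =
      Vertex.coset K.succPNat 1 := by
    intro f hf
    rw [Vertex.smul_coset, mul_one, eq_comm, Vertex.coset_eq_coset, inv_one, one_mul]
    exact ballSubgroup_mono F n ((hK ⟨f, hf, rfl⟩).trans (Nat.le_succ K)) (hk f)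
  have e : MulAction.fixedPoints H (Telescope F n) =
      {z | ∀ f ∈ S, (SemidirectProduct.inl f : Wreath F n) • z = z} := by
    ext z
    refine ⟨fun h f hf => h ⟨_, hf⟩, fun h γ => ?_⟩
    have h1 : (SemidirectProduct.inl γ.1.left : Wreath F n) = γ.1 :=
      SemidirectProduct.ext rfl (right_eq_one_of_finite H γ.2).symm
    have h2 := h γ.1.left (by rw [Set.mem_ofPred_eq, h1]; exact γ.2)
    rwa [h1] at h2
  rw [e]
  exact Telescope.contractible_fixed S _ hfix

end WreathFree

end

theorem mainTheorem4 {F : Type*} [Group F] [Finite F] (n : ℕ) (hn : 1 ≤ n) :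
    WreathFree.IsModelEProper (WreathFree.Wreath F n) (WreathFree.Telescope F n) 2 where
  t2 := inferInstance
  continuous_smul := inferInstance
  gcw := ⟨WreathFree.cwComplex F n, WreathFree.isGCW_cwComplex, WreathFree.hasDim_cwComplex hn⟩
  contractible_fixedPoints H _ := WreathFree.contractible_fixedPoints_of_finite H
  fixedPoints_empty H hH := by
    refine Set.eq_empty_of_forall_notMem fun z hz => ?_
    exact Set.infinite_coe_iff.1 hH
      ((WreathFree.Telescope.finite_stabilizer z).subset fun γ hγ => hz ⟨γ, hγ⟩)
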